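/- **Setting.** Let $(\mathcal X,\mathcal A,p,r,\gamma)$ be a discounted MDP with finite state space $\mathcal X$ and finite nonempty action space $\mathcal A$, rewards $r(x,a)\in[0,1]$, discount factor $\gamma\in[0,1)$ and initial-state distribution $\nu_0$. For a stationary policy $\pi$, started from $X_0\sim\nu_0$, let $\nu^\pi(x)=(1-\gamma)\sum_{t\ge0}\gamma^t\,\mathbb P_\pi(X_t=x)$, $\mu^\pi(x,a)=\pi(a|x)\nu^\pi(x)$, and let $q^\pi(x,a)=\mathbb E_\pi[\sum_{t\ge0}\gamma^t r(X_t,A_t)\mid X_0=x,A_0=a]$. The MDP is linear: there are a feature map $\varphi:\mathcal X\times\mathcal A\to\mathbb R^d$, vectors $\psi(x')\in\mathbb R^d$ and $\omega\in\mathbb R^d$ with $r(x,a)=\langle\varphi(x,a),\omega\rangle$ and $p(x'|x,a)=\langle\varphi(x,a),\psi(x')\rangle$, and $\|\varphi(x,a)\|_2\le D_\varphi$. Let $\pi_B$ be a behavior policy, $\mu_B=\mu^{\pi_B}$, and suppose that $\Lambda=\mathbb E_{(X,A)\sim\mu_B}[\varphi(X,A)\varphi(X,A)^{\mathsf T}]$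 is invertible. Then for every policy $\pi$ there is a unique $\theta^\pi$ with $q^\pi(x,a)=\langle\varphi(x,a),\theta^\pi\rangle$; suppose $\|\theta^\pi\|_2\le D_\theta$ for all $\pi$. Let $c\in\{\tfrac12,1\}$, $D_\beta\ge0$, and, for a policy $\pi^*$, $$C_{\varphi,c}(\pi^*;\pi_B)=\mathbb E_{\mu^{\pi^*}}[\varphi]^{\mathsf T}\Lambda^{-2c}\,\mathbb E_{\mu^{\pi^*}}[\varphi].$$ **Data and algorithm.** The data are $n=TK$ independent observations $(X^0,X,A,R,X')$ with $X^0\sim\nu_0$, $(X,A)\sim\mu_B$, $R=r(X,A)$, $X'\sim p(\cdot|X,A)$. The inputs are learning rates $\alpha,\zeta,\eta>0$, integers $T,K\ge1$, and $\theta_0,\beta_1$ with $\|\theta_0\|_2\le D_\theta$, $\|\beta_1\|_2\le D_\beta$; $\Pi_D$ is the Euclidean projection onto the centred ball of radius $D$. For $t=1,\dots,T$: let $\pi_t(a|x)\propto\exp(\alpha\sum_{i<t}\langle\varphi(x,a),\theta_i\rangle)$ (so $\pi_1$ is uniform) and $\theta_{t,1}=\theta_{t-1}$. For $k=1,\dots,K-1$,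 with a fresh observation $(X^0,X,A,R,X')$ and $\varphi_{t,k}=\varphi(X,A)$, put $$\mu_{t,k}(x,a)=\pi_t(a|x)\bigl((1-\gamma)\mathbf 1\{X^0=x\}+\gamma\langle\varphi_{t,k},\Lambda^{c-1}\beta_t\rangle\mathbf 1\{X'=x\}\bigr),$$ $$\theta_{t,k+1}=\Pi_{D_\theta}\Bigl(\theta_{t,k}-\eta\Bigl[\sum_{x,a}\mu_{t,k}(x,a)\varphi(x,a)-\varphi_{t,k}\langle\varphi_{t,k},\Lambda^{c-1}\beta_t\rangle\Bigr]\Bigr).$$ Then $\theta_t=\frac1K\sum_{k=1}^K\theta_{t,k}$, $v_t(x)=\sum_a\pi_t(a|x)\langle\varphi(x,a),\theta_t\rangle$ and, with one more fresh observation and $\varphi_t=\varphi(X,A)$, $$\beta_{t+1}=\Pi_{D_\beta}\bigl(\beta_t+\zeta\Lambda^{c-1}\varphi_t\,[R+\gamma v_t(X')-\langle\varphi_t,\theta_t\rangle]\bigr).$$ The output is $\pi_{\rm out}=\pi_J$ with $J$ uniform on $\{1,\dots,T\}$ and independent of the data. For $\tau,\ell\ge0$ put $$G_\beta^2(\tau)=3\bigl(1+(1+\gamma^2)D_\varphi^2D_\theta^2\bigr)\tau,\qquad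 G_\theta^2(\ell)=3D_\varphi^2\bigl((1-\gamma)^2+(1+\gamma^2)D_\beta^2\,\ell\bigr).$$ **Theorem.** (1) For every comparator policy $\pi^*$ with $C_{\varphi,c}(\pi^*;\pi_B)\le D_\beta^2$, with $\tau=\mathrm{Tr}(\Lambda^{2c-1})$ and $\ell=\|\Lambda\|_2^{2c-1}$, $$\mathbb E\bigl[\langle\mu^{\pi^*}-\mu^{\pi_{\rm out}},r\rangle\bigr]\le\frac{2D_\beta^2}{\zeta T}+\frac{\log|\mathcal A|}{\alpha T}+\frac{2D_\theta^2}{\eta K}+\frac{\zeta G_\beta^2(\tau)}2+\frac{\alpha D_\theta^2D_\varphi^2}2+\frac{\eta G_\theta^2(\ell)}2 .$$ (2) There is a universal constant $C>0$ such that the following holds whenever $|\mathcal A|\ge2$, $D_\varphi D_\theta\ge1$, $0<\varepsilon\le1$ and at least one policy has coverage ratio at most $D_\beta^2$. Let $(\tau,\ell)$ be either $(\mathrm{Tr}(\Lambda^{2c-1}),\|\Lambda\|_2^{2c-1})$ or $(D_\varphi^{2(2c-1)}d^{2-2c},D_\varphi^{2(2c-1)})$, write $G_\beta=G_\beta(\tau)$,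 $G_\theta=G_\theta(\ell)$, and, for each $T$, run the algorithm with $$K=\Bigl\lceil T\cdot\frac{2D_\theta^2G_\theta^2}{2D_\beta^2G_\beta^2+D_\theta^2D_\varphi^2\log|\mathcal A|}\Bigr\rceil,\quad \eta=\frac{2D_\theta}{G_\theta\sqrt K},\quad\zeta=\frac{2D_\beta}{G_\beta\sqrt T},\quad\alpha=\frac{\sqrt{2\log|\mathcal A|}}{D_\varphi D_\theta\sqrt T}.$$ Then there is $T_0\ge1$ such that $\mathbb E[\langle\mu^{\pi^*}-\mu^{\pi_{\rm out}},r\rangle]\le\varepsilon$ for all $T\ge T_0$ and all $\pi^*$ with $C_{\varphi,c}(\pi^*;\pi_B)\le D_\beta^2$, and the number of samples $n=T_0K$ used with $T=T_0$ is at most $$C\,\varepsilon^{-4}D_\theta^4D_\varphi^4D_\beta^4\,\mathrm{Tr}(\Lambda^{2c-1})\|\Lambda\|_2^{2c-1}\log|\mathcal A|$$ for the first choice of $(\tau,\ell)$, and at most $$C\,\varepsilon^{-4}D_\theta^4D_\varphi^{8c}D_\beta^4\,d^{2-2c}\log|\mathcal A|$$ for the second. -/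

import Mathlib

open MeasureTheory ProbabilityTheory
open scoped RealInnerProductSpace

universe w u v

noncomputable section

namespace OfflineRL

/-- The parameter space `ℝ^d` with its Euclidean norm. -/
abbrev Vec (d : ℕ) : Type := EuclideanSpace ℝ (Fin d)

/-! ### Discounted Markov decision processes -/

/-- A discounted MDP with finite state and action spaces, rewards in `[0, 1]`, discount factor
in `[0, 1)` and initial-state distribution `ν₀`. -/
structure MDP (X A : Type*) [Fintype X] where
  p : X → A → X → ℝ
  p_nonneg : ∀ x a y, 0 ≤ p x a y
  p_sum : ∀ x a, ∑ y, p x a y = 1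
  r : X → A → ℝ
  r_nonneg : ∀ x a, 0 ≤ r x a
  r_le_one : ∀ x a, r x a ≤ 1
  γ : ℝ
  γ_nonneg : 0 ≤ γ
  γ_lt_one : γ < 1
  ν₀ : X → ℝ
  ν₀_nonneg : ∀ x, 0 ≤ ν₀ x
  ν₀_sum : ∑ x, ν₀ x = 1

/-- A stationary stochastic policy; `π.prob x a` is `π(a | x)`. -/
structure Policy (X A : Type*) [Fintype A] where
  prob : X → A → ℝ
  nonneg : ∀ x a, 0 ≤ prob x a
  sum_one : ∀ x, ∑ a, prob x a = 1

variable {X A : Type*} [Fintype X] [Fintype A]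

namespace MDP

/-- Law of `(X_t, A_t)` when `(X_0, A_0) ∼ m`, `X_{t+1} ∼ p(· | X_t, A_t)` and, from time `1` on,
`A_t ∼ π(· | X_t)`. -/
def saLaw (M : MDP X A) (π : Policy X A) (m : X → A → ℝ) : ℕ → X → A → ℝ
  | 0 => m
  | t + 1 => fun y b => (∑ x, ∑ a, saLaw M π m t x a * M.p x a y) * π.prob y b

open Classical in
/-- Action-value function
`q^π(x, a) = E_π[∑_t γ^t r(X_t, A_t) | X_0 = x, A_0 = a]`. -/
def q (M : MDP X A) (π : Policy X A) (x : X) (a : A) : ℝ :=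
  ∑' t : ℕ, M.γ ^ t *
    ∑ y, ∑ b, M.saLaw π (fun x' a' => if x' = x ∧ a' = a then 1 else 0) t y b * M.r y b

/-- Discounted state occupancy measure `ν^π(x) = (1 - γ) ∑_t γ^t P_π(X_t = x)`, `X_0 ∼ ν₀`. -/
def stateOcc (M : MDP X A) (π : Policy X A) (x : X) : ℝ :=
  (1 - M.γ) * ∑' t : ℕ, M.γ ^ t * ∑ a, M.saLaw π (fun x' a' => M.ν₀ x' * π.prob x' a') t x a

/-- Discounted state-action occupancy measure `μ^π(x, a) = π(a | x) ν^π(x)`. -/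
def occ (M : MDP X A) (π : Policy X A) (x : X) (a : A) : ℝ :=
  π.prob x a * M.stateOcc π x

/-- `⟨μ^{π*} - μ^π, r⟩`, the suboptimality of `π` against the comparator `πs`. -/
def subopt (M : MDP X A) (πs π : Policy X A) : ℝ :=
  ∑ x, ∑ a, (M.occ πs x a - M.occ π x a) * M.r x a

variable {d : ℕ}

/-- Linear MDP with feature map `φ`. -/
def IsLinear (M : MDP X A) (φ : X → A → Vec d) : Prop :=
  ∃ (ψ : X → Vec d) (ω : Vec d),
    (∀ x a, M.r x a = ⟪φ x a, ω⟫) ∧ ∀ x a y, M.p x a y = ⟪φ x a, ψ y⟫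

/-- The feature covariance `Λ = E_{(X, A) ∼ μ^{π_B}}[φ(X, A) φ(X, A)ᵀ]`. -/
def featCov (M : MDP X A) (φ : X → A → Vec d) (πB : Policy X A) : Matrix (Fin d) (Fin d) ℝ :=
  Matrix.of fun i j => ∑ x, ∑ a, M.occ πB x a * (φ x a i * φ x a j)

end MDP

/-! ### Powers of the covariance matrix -/

/-- Real power `L ^ s` of a symmetric matrix, through the spectral decomposition. -/
def matPow {d : ℕ} (L : Matrix (Fin d) (Fin d) ℝ) (s : ℝ) : Matrix (Fin d) (Fin d) ℝ :=
  cfc (fun x : ℝ => x ^ s) L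

/-- `L ^ s` applied to a vector. -/
def powApply {d : ℕ} (L : Matrix (Fin d) (Fin d) ℝ) (s : ℝ) (v : Vec d) : Vec d :=
  Matrix.toEuclideanCLM (𝕜 := ℝ) (matPow L s) v

/-- The operator norm `‖L‖₂`. -/
def opNorm {d : ℕ} (L : Matrix (Fin d) (Fin d) ℝ) : ℝ :=
  ‖Matrix.toEuclideanCLM (𝕜 := ℝ) L‖

/-- Generalized coverage ratio
`C_{φ,c}(π*; π_B) = E_{μ^{π*}}[φ]ᵀ Λ^{-2c} E_{μ^{π*}}[φ]`. -/
def coverage {d : ℕ} (M : MDP X A) (φ : X → A → Vec d) (c : ℝ) (πs πB : Policy X A) : ℝ :=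
  ⟪∑ x, ∑ a, M.occ πs x a • φ x a,
    powApply (M.featCov φ πB) (-(2 * c)) (∑ x, ∑ a, M.occ πs x a • φ x a)⟫

/-! ### Offline data -/

/-- One observation `(X⁰, X, A, X')`; the reward is `r(X, A)`. -/
structure Sample (X A : Type*) where
  x0 : X
  x : X
  a : A
  xnext : X

instance {X A : Type*} : MeasurableSpace (Sample X A) := ⊤

/-- `W 0, …, W (n - 1)` are independent observations with `X⁰ ∼ ν₀`, `(X, A) ∼ μ^{π_B}` and
`X' ∼ p(· | X, A)`. Nothing is required of `W i` for `i ≥ n`. -/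
structure IsDataset (M : MDP X A) (πB : Policy X A) {Ω : Type*} [MeasurableSpace Ω]
    (P : Measure Ω) (n : ℕ) (W : ℕ → Ω → Sample X A) : Prop where
  measurable : ∀ i < n, Measurable (W i)
  indep : iIndepFun (fun i : Fin n => W i) P
  law_init : ∀ i < n, ∀ x, P.real {ω | (W i ω).x0 = x} = M.ν₀ x
  law_trans : ∀ i < n, ∀ x a y,
    P.real {ω | (W i ω).x = x ∧ (W i ω).a = a ∧ (W i ω).xnext = y} = M.occ πB x a * M.p x a y

/-- `J` is uniform on the `T` iterations and independent of the first `n` observations. -/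
structure IsUniformIndex {Ω : Type*} [MeasurableSpace Ω] (P : Measure Ω) (n : ℕ)
    (W : ℕ → Ω → Sample X A) {T : ℕ} (J : Ω → Fin T) : Prop where
  measurable : Measurable J
  law : ∀ j, P.real {ω | J ω = j} = 1 / T
  indep : IndepFun J (fun ω (i : Fin n) => W i ω) P

/-! ### The algorithm -/

/-- Euclidean projection onto the centred closed ball of radius `D ≥ 0`. -/
def projBall {d : ℕ} (D : ℝ) (v : Vec d) : Vec d :=
  if ‖v‖ ≤ D then v else (D / ‖v‖) • v

/-- The softmax policy `π(a | x) ∝ exp (u(x, a))`. -/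
def softmaxPolicy [Nonempty A] (u : X → A → ℝ) : Policy X A where
  prob x a := Real.exp (u x a) / ∑ b, Real.exp (u x b)
  nonneg x a := by positivity
  sum_one x := by
    rw [← Finset.sum_div]
    exact div_self (Finset.sum_pos (fun _ _ => Real.exp_pos _) Finset.univ_nonempty).ne'

/-- Inputs of the algorithm: the exponent `c`, the radii of the two balls, the learning rates, the
length `K` of the inner loop and the initial points. -/
structure AlgInput (d : ℕ) where
  c : ℝ
  Dθ : ℝ
  Dβ : ℝ
  α : ℝ
  ζ : ℝ
  η : ℝ
  K : ℕ
  θ₀ : Vec d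
  β₁ : Vec d

/-- The variables carried from one outer iteration to the next. At the start of iteration `t`
(counted from `1`) they are `θ_{t-1}`, `θ_1 + ⋯ + θ_{t-1}` and `β_t`. -/
structure AlgState (d : ℕ) where
  θprev : Vec d
  θsum : Vec d
  β : Vec d

variable {d : ℕ}

open Classical in
/-- `μ_{t,k}(x, a) = π_t(a | x) ((1 - γ) 1{X⁰ = x} + γ ⟨φ(X, A), Λ^{c-1} β_t⟩ 1{X' = x})`. -/
def muEst (M : MDP X A) (φ : X → A → Vec d) (L : Matrix (Fin d) (Fin d) ℝ) (c : ℝ)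
    (π : Policy X A) (β : Vec d) (s : Sample X A) (x : X) (a : A) : ℝ :=
  π.prob x a * ((1 - M.γ) * (if s.x0 = x then 1 else 0) +
    M.γ * ⟪φ s.x s.a, powApply L (c - 1) β⟫ * (if s.xnext = x then 1 else 0))

/-- Gradient estimate for `θ`: `Φᵀ μ_{t,k} - φ(X, A) ⟨φ(X, A), Λ^{c-1} β_t⟩`. -/
def gradθ (M : MDP X A) (φ : X → A → Vec d) (L : Matrix (Fin d) (Fin d) ℝ) (c : ℝ)
    (π : Policy X A) (β : Vec d) (s : Sample X A) : Vec d :=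
  (∑ x, ∑ a, muEst M φ L c π β s x a • φ x a) -
    ⟪φ s.x s.a, powApply L (c - 1) β⟫ • φ s.x s.a

/-- Gradient estimate for `β`: `Λ^{c-1} φ(X, A) (R + γ v_t(X') - ⟨φ(X, A), θ_t⟩)` with
`v_t(x) = ∑_a π_t(a | x) ⟨φ(x, a), θ_t⟩`. -/
def gradβ (M : MDP X A) (φ : X → A → Vec d) (L : Matrix (Fin d) (Fin d) ℝ) (c : ℝ)
    (π : Policy X A) (θ : Vec d) (s : Sample X A) : Vec d :=
  (M.r s.x s.a + M.γ * (∑ b, π.prob s.xnext b * ⟪φ s.xnext b, θ⟫) - ⟪φ s.x s.a, θ⟫) •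
    powApply L (c - 1) (φ s.x s.a)

/-- The policy played in an iteration that starts from the state `S`. -/
def statePolicy [Nonempty A] (φ : X → A → Vec d) (I : AlgInput d) (S : AlgState d) : Policy X A :=
  softmaxPolicy fun x a => I.α * ⟪φ x a, S.θsum⟫

/-- The inner loop of projected stochastic gradient descent, fed with the observations
`w 0, w 1, …`; `innerθ … k` is `θ_{t,k+1}`. -/
def innerθ [Nonempty A] (M : MDP X A) (φ : X → A → Vec d) (L : Matrix (Fin d) (Fin d) ℝ)
    (I : AlgInput d) (S : AlgState d) (w : ℕ → Sample X A) : ℕ → Vec d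
  | 0 => S.θprev
  | k + 1 => projBall I.Dθ (innerθ M φ L I S w k -
      I.η • gradθ M φ L I.c (statePolicy φ I S) S.β (w k))

/-- The average `θ_t` of the `K` inner iterates `θ_{t,1}, …, θ_{t,K}`
(which use the `K - 1` observations `w 0, …, w (K - 2)`). -/
def avgθ [Nonempty A] (M : MDP X A) (φ : X → A → Vec d) (L : Matrix (Fin d) (Fin d) ℝ)
    (I : AlgInput d) (S : AlgState d) (w : ℕ → Sample X A) : Vec d :=
  (1 / (I.K : ℝ)) • ∑ k ∈ Finset.range I.K, innerθ M φ L I S w k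

/-- One outer iteration on the `K` observations `w 0, …, w (K - 1)`, the last of which is used in
the ascent step for `β`. -/
def outerStep [Nonempty A] (M : MDP X A) (φ : X → A → Vec d) (L : Matrix (Fin d) (Fin d) ℝ)
    (I : AlgInput d) (w : ℕ → Sample X A) (S : AlgState d) : AlgState d where
  θprev := avgθ M φ L I S w
  θsum := S.θsum + avgθ M φ L I S w
  β := projBall I.Dβ (S.β +
    I.ζ • gradβ M φ L I.c (statePolicy φ I S) (avgθ M φ L I S w) (w (I.K - 1)))

/-- State of the algorithm after `t` outer iterations on the data `w`; iteration number `t + 1`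
consumes the observations `w (t * K), …, w (t * K + K - 1)`. -/
def algState [Nonempty A] (M : MDP X A) (φ : X → A → Vec d) (L : Matrix (Fin d) (Fin d) ℝ)
    (I : AlgInput d) (w : ℕ → Sample X A) : ℕ → AlgState d
  | 0 => ⟨I.θ₀, 0, I.β₁⟩
  | t + 1 => outerStep M φ L I (fun k => w (t * I.K + k)) (algState M φ L I w t)

/-- The policy `π_{t+1}` of the algorithm; the first one is uniform. -/
def algPolicy [Nonempty A] (M : MDP X A) (φ : X → A → Vec d) (L : Matrix (Fin d) (Fin d) ℝ)
    (I : AlgInput d) (w : ℕ → Sample X A) (t : ℕ) : Policy X A :=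
  statePolicy φ I (algState M φ L I w t)

/-- `E[⟨μ^{π*} - μ^{π_out}, r⟩]` for the output `π_out = π_J` of the algorithm run on the random
data `W`. -/
def expSubopt [Nonempty A] (M : MDP X A) (φ : X → A → Vec d) (πB πs : Policy X A)
    (I : AlgInput d) {Ω : Type*} [MeasurableSpace Ω] (P : Measure Ω) (W : ℕ → Ω → Sample X A)
    {T : ℕ} (J : Ω → Fin T) : ℝ :=
  ∫ ω, M.subopt πs (algPolicy M φ (M.featCov φ πB) I (fun i => W i ω) (J ω)) ∂P

/-! ### Constants and tuning -/

/-- `G_θ² = 3 D_φ² ((1 - γ)² + (1 + γ²) D_β² ℓ)`, where `ℓ` stands for `‖Λ‖₂^{2c-1}` or an upper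
bound of it. -/
def Gθsq (γ Dφ Dβ ℓ : ℝ) : ℝ :=
  3 * Dφ ^ 2 * ((1 - γ) ^ 2 + (1 + γ ^ 2) * Dβ ^ 2 * ℓ)

/-- `G_β² = 3 (1 + (1 + γ²) D_φ² D_θ²) τ`, where `τ` stands for `Tr(Λ^{2c-1})` or an upper bound
of it. -/
def Gβsq (γ Dφ Dθ τ : ℝ) : ℝ :=
  3 * (1 + (1 + γ ^ 2) * Dφ ^ 2 * Dθ ^ 2) * τ

/-- Length of the inner loop for `T` outer iterations. -/
def tunedK (γ Dφ Dθ Dβ τ ℓ logA : ℝ) (T : ℕ) : ℕ :=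
  ⌈(T : ℝ) * ((2 * Dθ ^ 2 * Gθsq γ Dφ Dβ ℓ) /
    (2 * Dβ ^ 2 * Gβsq γ Dφ Dθ τ + Dθ ^ 2 * Dφ ^ 2 * logA))⌉₊

/-- The algorithm with tuned learning rates and inner loop, for `T` outer iterations. -/
def tunedInput (c γ Dφ Dθ Dβ τ ℓ logA : ℝ) (T : ℕ) (θ₀ β₁ : Vec d) : AlgInput d where
  c := c
  Dθ := Dθ
  Dβ := Dβ
  α := √(2 * logA) / (Dφ * Dθ * √T)
  ζ := 2 * Dβ / (√(Gβsq γ Dφ Dθ τ) * √T)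
  η := 2 * Dθ / (√(Gθsq γ Dφ Dβ ℓ) * √(tunedK γ Dφ Dθ Dβ τ ℓ logA T : ℝ))
  K := tunedK γ Dφ Dθ Dβ τ ℓ logA T
  θ₀ := θ₀
  β₁ := β₁

/-- The tuned algorithm reaches expected suboptimality `ε` with at most `N` samples: some number
`T₀` of outer iterations uses at most `N` samples in total, and with `T₀` or more iterations the
expected suboptimality is at most `ε` against every comparator whose coverage ratio is at most
`D_β²`, whatever the initial points and the probability space carrying the data. -/
def ReachesWithin {X : Type u} {A : Type v} [Fintype X] [Fintype A] [Nonempty A] {d : ℕ}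
    (M : MDP X A) (φ : X → A → Vec d) (πB : Policy X A) (c Dφ Dθ Dβ τ ℓ ε N : ℝ) : Prop :=
  ∃ T₀ : ℕ, 1 ≤ T₀ ∧
    ((T₀ * tunedK M.γ Dφ Dθ Dβ τ ℓ (Real.log (Fintype.card A)) T₀ : ℕ) : ℝ) ≤ N ∧
    ∀ T : ℕ, T₀ ≤ T → ∀ πs : Policy X A, coverage M φ c πs πB ≤ Dβ ^ 2 →
      ∀ θ₀ β₁ : Vec d, ‖θ₀‖ ≤ Dθ → ‖β₁‖ ≤ Dβ →
      ∀ I : AlgInput d,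
        I = tunedInput c M.γ Dφ Dθ Dβ τ ℓ (Real.log (Fintype.card A)) T θ₀ β₁ →
      ∀ (Ω : Type w) [MeasurableSpace Ω] (P : Measure Ω) [IsProbabilityMeasure P]
        (W : ℕ → Ω → Sample X A) (J : Ω → Fin T),
        IsDataset M πB P (T * I.K) W → IsUniformIndex P (T * I.K) W J →
        expSubopt M φ πB πs I P W J ≤ ε

end OfflineRL

end

/-! The algorithm plays a saddle-point game for the Lagrangian f(β, θ; π) = (1-γ)⟨ν₀, v⟩ +
E_{μ_B}[⟨φ, Λ^{c-1}β⟩ (r + γPv - ⟨φ, θ⟩)], where v(x) = ∑_a π(a|x)⟨φ(x,a), θ⟩. It is affine in β and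
in θ separately, with gradients `meanGradβ` and `meanGradθ`. At θ = θ^π the Bellman equation makes f
equal to ⟨μ^π, r⟩ for every β. At β* = Λ^{-c}E_{μ^{π*}}[φ], linearity of the MDP turns the
expectation under μ_B into one under μ^{π*}, and the flow equation makes f equal to ⟨μ^{π*}, r⟩
minus a policy-regret term. Hence `subopt_eq`: the suboptimality is exactly a policy regret plus a
gradient regret for β against β* plus one for θ against θ^π. Moreover ‖β*‖² is the coverage ratio,
so β* lies in the ball onto which β is projected.

The policy regret is the exponential-weights regret in each state, averaged under ν^{π*}
(`exp_weights_regret`, `policy_regret_le`). The comparator β* is fixed, so one ascent step per outer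
iteration suffices and the squared distances telescope over t. The comparator θ^{π_t} moves with t,
which is why an inner loop is run with π_t and β_t frozen; there the distances telescope over k, and
affinity in θ passes to the average. Each step uses an observation independent of the current
iterate (`IsDataset.integral_fresh_le`, with the `dependsOn_` lemmas), so stochastic gradients may
be replaced by their means. Their second moments bring in Tr(Λ^{2c-1}) and ‖Λ‖^{2c-1}. Together this
gives `expSubopt_le`.

For the sample complexity, the learning rates balance the two terms of each regret and K equalises
the inner and outer errors. To absorb the additive constants in G_θ² and in the rounding one needs 1
≤ D_β²‖Λ‖^{2c-1}, which `one_le_coverage_mul` derives from the normalisation of the transition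
kernel. -/

namespace OfflineRL

/-! ### Occupancy measures and action values -/

namespace MDP

variable {X A : Type*} [Fintype X] [Fintype A]

/-- One transition of the state-action chain under `π`, as a linear map on signed laws. -/
noncomputable def stepMap (M : MDP X A) (π : Policy X A) : (X → A → ℝ) →ₗ[ℝ] (X → A → ℝ) where
  toFun m y b := (∑ x, ∑ a, m x a * M.p x a y) * π.prob y b
  map_add' m m' := by
    ext y b
    simp [add_mul, Finset.sum_add_distrib]
  map_smul' k m := by
    ext y b
    simp [Finset.sum_mul, Finset.mul_sum, mul_assoc]

/-- Makes the law linear in its initial condition, and lets the first transition be split off where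
the recursion splits off the last. -/
lemma saLaw_eq_pow (M : MDP X A) (π : Policy X A) (m : X → A → ℝ) (t : ℕ) :
    M.saLaw π m t = (M.stepMap π ^ t) m := by
  induction t with
  | zero => rfl
  | succ t ih =>
    rw [pow_succ', Module.End.mul_apply, ← ih]
    rfl

lemma saLaw_nonneg (M : MDP X A) (π : Policy X A) {m : X → A → ℝ} (hm : ∀ x a, 0 ≤ m x a)
    (t : ℕ) (x : X) (a : A) : 0 ≤ M.saLaw π m t x a := by
  induction t generalizing x a with
  | zero => exact hm x a
  | succ t ih =>
    exact mul_nonneg (Finset.sum_nonneg fun y _ => Finset.sum_nonneg fun b _ =>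
      mul_nonneg (ih y b) (M.p_nonneg _ _ _)) (π.nonneg _ _)

lemma sum_saLaw (M : MDP X A) (π : Policy X A) (m : X → A → ℝ) (t : ℕ) :
    ∑ x, ∑ a, M.saLaw π m t x a = ∑ x, ∑ a, m x a := by
  induction t with
  | zero => rfl
  | succ t ih =>
    rw [← ih]
    simp only [saLaw, ← Finset.mul_sum, π.sum_one, mul_one]
    rw [Finset.sum_comm]
    refine Finset.sum_congr rfl fun x _ => ?_
    rw [Finset.sum_comm]
    refine Finset.sum_congr rfl fun a _ => ?_
    rw [← Finset.mul_sum, M.p_sum, mul_one]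

lemma sum_saLaw_mul_le (M : MDP X A) (π : Policy X A) {m : X → A → ℝ} (hm : ∀ x a, 0 ≤ m x a)
    (t : ℕ) {f : X → A → ℝ} (hf : ∀ x a, f x a ≤ 1) :
    ∑ x, ∑ a, M.saLaw π m t x a * f x a ≤ ∑ x, ∑ a, m x a := by
  rw [← M.sum_saLaw π m t]
  exact Finset.sum_le_sum fun x _ => Finset.sum_le_sum fun a _ =>
    mul_le_of_le_one_right (M.saLaw_nonneg π hm t x a) (hf x a)

set_option linter.unusedSectionVars false in
lemma summable_discounted (M : MDP X A) {f : ℕ → ℝ} (h0 : ∀ t, 0 ≤ f t) {b : ℝ}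
    (h1 : ∀ t, f t ≤ b) : Summable fun t => M.γ ^ t * f t :=
  Summable.of_nonneg_of_le (fun t => mul_nonneg (pow_nonneg M.γ_nonneg t) (h0 t))
    (fun t => mul_le_mul_of_nonneg_left (h1 t) (pow_nonneg M.γ_nonneg t))
    ((summable_geometric_of_lt_one M.γ_nonneg M.γ_lt_one).mul_right b)

/-- Law of the state at time `t` when `X₀ ∼ ν₀`. -/
noncomputable def stateLaw (M : MDP X A) (π : Policy X A) (t : ℕ) (x : X) : ℝ :=
  ∑ a, M.saLaw π (fun x' a' => M.ν₀ x' * π.prob x' a') t x a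

lemma stateLaw_zero (M : MDP X A) (π : Policy X A) (x : X) : M.stateLaw π 0 x = M.ν₀ x := by
  simp [stateLaw, saLaw, ← Finset.mul_sum, π.sum_one]

/-- The initial law is itself ν₀ ⊗ π, so the action has conditional law π at time 0 as well as
later. -/
lemma saLaw_eq_stateLaw_mul (M : MDP X A) (π : Policy X A) (t : ℕ) (x : X) (a : A) :
    M.saLaw π (fun x' a' => M.ν₀ x' * π.prob x' a') t x a = M.stateLaw π t x * π.prob x a := by
  cases t with
  | zero => rw [stateLaw_zero]; rfl
  | succ t => simp [stateLaw, saLaw, ← Finset.mul_sum, π.sum_one]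

lemma stateLaw_succ (M : MDP X A) (π : Policy X A) (t : ℕ) (y : X) :
    M.stateLaw π (t + 1) y = ∑ x, ∑ a, M.stateLaw π t x * (π.prob x a * M.p x a y) := by
  rw [stateLaw]
  simp only [saLaw, ← Finset.mul_sum, π.sum_one, mul_one, saLaw_eq_stateLaw_mul]
  simp only [Finset.mul_sum, mul_assoc]

lemma stateLaw_nonneg (M : MDP X A) (π : Policy X A) (t : ℕ) (x : X) : 0 ≤ M.stateLaw π t x :=
  Finset.sum_nonneg fun a _ =>
    M.saLaw_nonneg π (fun x a => mul_nonneg (M.ν₀_nonneg x) (π.nonneg x a)) t x a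

lemma sum_stateLaw (M : MDP X A) (π : Policy X A) (t : ℕ) : ∑ x, M.stateLaw π t x = 1 := by
  simp only [stateLaw]
  rw [sum_saLaw]
  simp only [← Finset.mul_sum, π.sum_one, mul_one, M.ν₀_sum]

lemma stateLaw_le_one (M : MDP X A) (π : Policy X A) (t : ℕ) (x : X) : M.stateLaw π t x ≤ 1 := by
  rw [← M.sum_stateLaw π t]
  exact Finset.single_le_sum (f := M.stateLaw π t) (fun y _ => M.stateLaw_nonneg π t y)
    (Finset.mem_univ x)

set_option linter.unusedSectionVars false in
lemma one_sub_γ_pos (M : MDP X A) : 0 < 1 - M.γ := sub_pos.2 M.γ_lt_one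

lemma hasSum_stateOcc (M : MDP X A) (π : Policy X A) (x : X) :
    HasSum (fun t => (1 - M.γ) * (M.γ ^ t * M.stateLaw π t x)) (M.stateOcc π x) :=
  (M.summable_discounted (fun t => M.stateLaw_nonneg π t x)
    (fun t => M.stateLaw_le_one π t x)).hasSum.mul_left _

lemma stateOcc_nonneg (M : MDP X A) (π : Policy X A) (x : X) : 0 ≤ M.stateOcc π x :=
  (M.hasSum_stateOcc π x).nonneg fun t => mul_nonneg M.one_sub_γ_pos.le
    (mul_nonneg (pow_nonneg M.γ_nonneg t) (M.stateLaw_nonneg π t x))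

lemma occ_nonneg (M : MDP X A) (π : Policy X A) (x : X) (a : A) : 0 ≤ M.occ π x a :=
  mul_nonneg (π.nonneg x a) (M.stateOcc_nonneg π x)

/-- The Bellman flow equation. -/
lemma stateOcc_flow (M : MDP X A) (π : Policy X A) (y : X) :
    M.stateOcc π y = (1 - M.γ) * M.ν₀ y + M.γ * ∑ x, ∑ a, M.occ π x a * M.p x a y := by
  -- Split off t = 0; one transition then expresses the shifted series through the occupancy itself.
  have h := (hasSum_nat_add_iff' 1).2 (M.hasSum_stateOcc π y)
  have h2 : HasSum (fun t => (1 - M.γ) * (M.γ ^ (t + 1) * M.stateLaw π (t + 1) y))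
      (M.γ * ∑ x, ∑ a, M.occ π x a * M.p x a y) := by
    have : HasSum (fun t => M.γ * ∑ x, ∑ a, π.prob x a *
        ((1 - M.γ) * (M.γ ^ t * M.stateLaw π t x)) * M.p x a y)
        (M.γ * ∑ x, ∑ a, M.occ π x a * M.p x a y) :=
      (hasSum_sum fun x _ => hasSum_sum fun a _ =>
        ((M.hasSum_stateOcc π x).mul_left _).mul_right _).mul_left _
    convert this using 2 with t
    rw [stateLaw_succ]
    simp only [Finset.mul_sum]
    refine Finset.sum_congr rfl fun x _ => Finset.sum_congr rfl fun a _ => ?_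
    ring
  have := h.unique h2
  simp only [Finset.sum_range_one, pow_zero, stateLaw_zero] at this
  linarith

lemma sum_occ_action (M : MDP X A) (π : Policy X A) (x : X) :
    ∑ a, M.occ π x a = M.stateOcc π x := by
  simp only [occ, ← Finset.sum_mul, π.sum_one, one_mul]

/-- The flow equation tested against a function of the state. -/
lemma sum_stateOcc_mul (M : MDP X A) (π : Policy X A) (f : X → ℝ) :
    ∑ x, M.stateOcc π x * f x = (1 - M.γ) * ∑ x, M.ν₀ x * f x +
      M.γ * ∑ x, ∑ a, M.occ π x a * ∑ y, M.p x a y * f y := by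
  have : ∀ y, M.stateOcc π y * f y = (1 - M.γ) * (M.ν₀ y * f y) +
      M.γ * ∑ x, ∑ a, M.occ π x a * (M.p x a y * f y) := by
    intro y
    rw [M.stateOcc_flow π y, add_mul, mul_assoc, mul_assoc]
    simp only [Finset.sum_mul, mul_assoc]
  rw [Finset.sum_congr rfl fun y _ => this y, Finset.sum_add_distrib, ← Finset.mul_sum,
    ← Finset.mul_sum, Finset.sum_comm]
  congr 2
  refine Finset.sum_congr rfl fun x _ => ?_
  rw [Finset.sum_comm]
  simp only [Finset.mul_sum]

/-- Test the flow equation against the constant 1 and divide by 1 - γ > 0. -/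
lemma sum_stateOcc (M : MDP X A) (π : Policy X A) : ∑ x, M.stateOcc π x = 1 := by
  have h := M.sum_stateOcc_mul π 1
  simp only [Pi.one_apply, mul_one, M.ν₀_sum, M.p_sum, sum_occ_action] at h
  have h1 : (1 - M.γ) * (∑ x, M.stateOcc π x - 1) = 0 := by linear_combination h
  rcases mul_eq_zero.1 h1 with h2 | h2
  · exact absurd h2 M.one_sub_γ_pos.ne'
  · linarith

lemma sum_occ (M : MDP X A) (π : Policy X A) : ∑ x, ∑ a, M.occ π x a = 1 := by
  simp only [sum_occ_action, sum_stateOcc]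

open Classical in
/-- The Bellman equation for the action-value function. -/
lemma q_eq (M : MDP X A) (π : Policy X A) (x : X) (a : A) :
    M.q π x a = M.r x a + M.γ * ∑ y, M.p x a y * ∑ b, π.prob y b * M.q π y b := by
  set δ : X → A → X → A → ℝ := fun x a x' a' => if x' = x ∧ a' = a then 1 else 0 with hδ
  set R : ℕ → (X → A → ℝ) → ℝ := fun t m => ∑ y, ∑ b, M.saLaw π m t y b * M.r y b with hR
  have hδ0 : ∀ x a x' a', 0 ≤ δ x a x' a' := fun x a x' a' => by
    simp only [hδ]; split_ifs <;> norm_num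
  have hδ1 : ∀ x a, ∑ x', ∑ a', δ x a x' a' = 1 := fun x a => by
    simp [hδ, ite_and]
  have hsum : ∀ x a, HasSum (fun t => M.γ ^ t * R t (δ x a)) (M.q π x a) := fun x a =>
    (M.summable_discounted (f := fun t => R t (δ x a)) (b := 1)
      (fun t => Finset.sum_nonneg fun y _ => Finset.sum_nonneg fun b _ =>
        mul_nonneg (M.saLaw_nonneg π (hδ0 x a) t y b) (M.r_nonneg y b))
      (fun t => (M.sum_saLaw_mul_le π (hδ0 x a) t M.r_le_one).trans_eq (hδ1 x a))).hasSum
  -- The expected reward at time t is linear in the initial law, hence a mixture over point masses.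
  have hlin : ∀ t m, R t m = ∑ y, ∑ b, m y b * R t (δ y b) := by
    intro t m
    have hm : m = ∑ y, ∑ b, m y b • δ y b := by
      ext x' a'
      simp [hδ, Finset.sum_apply, ite_and]
    have : M.saLaw π m t = ∑ y, ∑ b, m y b • M.saLaw π (δ y b) t := by
      simp only [saLaw_eq_pow]
      conv_lhs => rw [hm]
      simp only [map_sum, map_smul]
    simp only [hR, this, Finset.sum_apply, Pi.smul_apply, smul_eq_mul, Finset.sum_mul,
      Finset.mul_sum]
    refine ((Finset.sum_congr rfl fun y _ => Finset.sum_comm).trans Finset.sum_comm).trans ?_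
    refine Finset.sum_congr rfl fun y _ => ?_
    refine ((Finset.sum_congr rfl fun y _ => Finset.sum_comm).trans Finset.sum_comm).trans ?_
    simp only [mul_assoc]
  -- First-step analysis: one transition from the point mass at (x, a) gives the law p(·|x,a) ⊗ π.
  have hstep : ∀ t x a, R (t + 1) (δ x a) =
      ∑ y, ∑ b, (M.p x a y * π.prob y b) * R t (δ y b) := by
    intro t x a
    have h1 : M.stepMap π (δ x a) = fun y b => M.p x a y * π.prob y b := by
      ext y b
      simp [stepMap, hδ, ite_and]
    rw [← hlin t (fun y b => M.p x a y * π.prob y b), ← h1]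
    simp only [hR, saLaw_eq_pow, pow_succ, Module.End.mul_apply]
  have h := (hasSum_nat_add_iff' 1).2 (hsum x a)
  have h2 : HasSum (fun t => M.γ ^ (t + 1) * R (t + 1) (δ x a))
      (M.γ * ∑ y, ∑ b, (M.p x a y * π.prob y b) * M.q π y b) := by
    have : HasSum (fun t => M.γ * ∑ y, ∑ b, (M.p x a y * π.prob y b) *
        (M.γ ^ t * R t (δ y b))) (M.γ * ∑ y, ∑ b, (M.p x a y * π.prob y b) * M.q π y b) :=
      (hasSum_sum fun y _ => hasSum_sum fun b _ => (hsum y b).mul_left _).mul_left _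
    convert this using 2 with t
    rw [hstep]
    simp only [Finset.mul_sum]
    refine Finset.sum_congr rfl fun y _ => Finset.sum_congr rfl fun b _ => ?_
    ring
  have h3 := h.unique h2
  have h4 : R 0 (δ x a) = M.r x a := by
    simp [hR, saLaw, hδ, ite_and]
  simp only [Finset.sum_range_one, pow_zero, one_mul, h4] at h3
  simp only [Finset.mul_sum] at h3 ⊢
  simp only [mul_assoc] at h3
  linarith

/-- `⟨μ^π, r⟩ = (1 - γ) ⟨ν₀, v^π⟩`. -/
lemma sum_occ_mul_reward (M : MDP X A) (π : Policy X A) :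
    ∑ x, ∑ a, M.occ π x a * M.r x a =
      (1 - M.γ) * ∑ x, M.ν₀ x * ∑ a, π.prob x a * M.q π x a := by
  -- Testing the flow equation against v^π and substituting the Bellman equation cancels the terms
  -- in γPv^π.
  have h := M.sum_stateOcc_mul π (fun x => ∑ a, π.prob x a * M.q π x a)
  have h1 : ∑ x, M.stateOcc π x * ∑ a, π.prob x a * M.q π x a =
      ∑ x, ∑ a, M.occ π x a * M.q π x a := by
    simp only [Finset.mul_sum, occ]
    refine Finset.sum_congr rfl fun x _ => Finset.sum_congr rfl fun a _ => ?_
    ring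
  have h2 : ∑ x, ∑ a, M.occ π x a * M.q π x a = ∑ x, ∑ a, M.occ π x a * M.r x a +
      M.γ * ∑ x, ∑ a, M.occ π x a * ∑ y, M.p x a y * ∑ b, π.prob y b * M.q π y b := by
    rw [Finset.mul_sum, ← Finset.sum_add_distrib]
    refine Finset.sum_congr rfl fun x _ => ?_
    rw [Finset.mul_sum, ← Finset.sum_add_distrib]
    refine Finset.sum_congr rfl fun a _ => ?_
    conv_lhs => rw [M.q_eq π x a]
    ring
  linarith

end MDP

/-! ### The feature covariance and its powers -/

section Covariance

variable {X A : Type*} [Fintype X] [Fintype A] {d : ℕ}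

lemma spectrum_pos_of_posDef {L : Matrix (Fin d) (Fin d) ℝ} (hL : L.PosDef) {x : ℝ}
    (hx : x ∈ spectrum ℝ L) : 0 < x := by
  rw [hL.1.spectrum_real_eq_range_eigenvalues] at hx
  obtain ⟨i, rfl⟩ := hx
  exact hL.eigenvalues_pos i

/-- The spectrum is positive, so x ↦ x^s is continuous on it and exponents add, negative ones
included. -/
lemma matPow_mul {L : Matrix (Fin d) (Fin d) ℝ} (hL : L.PosDef) (s t : ℝ) :
    matPow L s * matPow L t = matPow L (s + t) := by
  have hc : ∀ s : ℝ, ContinuousOn (fun x : ℝ => x ^ s) (spectrum ℝ L) := fun s x hx =>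
    (Real.continuousAt_rpow_const x s (Or.inl (spectrum_pos_of_posDef hL hx).ne')).continuousWithinAt
  rw [matPow, matPow, ← cfc_mul _ _ L (hc s) (hc t)]
  exact cfc_congr fun x hx => (Real.rpow_add (spectrum_pos_of_posDef hL hx) s t).symm

lemma matPow_one {L : Matrix (Fin d) (Fin d) ℝ} (hL : L.PosDef) : matPow L 1 = L := by
  simp only [matPow, Real.rpow_one]
  exact cfc_id' ℝ L hL.1.isSelfAdjoint

lemma matPow_zero {L : Matrix (Fin d) (Fin d) ℝ} (hL : L.PosDef) : matPow L 0 = 1 := by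
  simp only [matPow, Real.rpow_zero]
  exact cfc_const_one ℝ L hL.1.isSelfAdjoint

lemma powApply_powApply {L : Matrix (Fin d) (Fin d) ℝ} (hL : L.PosDef) (s t : ℝ) (v : Vec d) :
    powApply L s (powApply L t v) = powApply L (s + t) v := by
  rw [powApply, powApply, powApply, ← matPow_mul hL, map_mul]
  rfl

lemma powApply_one {L : Matrix (Fin d) (Fin d) ℝ} (hL : L.PosDef) (v : Vec d) :
    powApply L 1 v = Matrix.toEuclideanCLM (𝕜 := ℝ) L v := by
  rw [powApply, matPow_one hL]

lemma powApply_zero {L : Matrix (Fin d) (Fin d) ℝ} (hL : L.PosDef) (v : Vec d) :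
    powApply L 0 v = v := by
  rw [powApply, matPow_zero hL, map_one]
  rfl

lemma inner_powApply_left (L : Matrix (Fin d) (Fin d) ℝ) (s : ℝ) (u v : Vec d) :
    ⟪powApply L s u, v⟫ = ⟪u, powApply L s v⟫ := by
  have h : IsSelfAdjoint (matPow L s) := cfc_predicate _ L
  have h2 : ContinuousLinearMap.adjoint (Matrix.toEuclideanCLM (𝕜 := ℝ) (matPow L s)) =
      Matrix.toEuclideanCLM (𝕜 := ℝ) (matPow L s) := by
    rw [← ContinuousLinearMap.star_eq_adjoint, ← map_star, h.star_eq]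
  rw [powApply, powApply, ← ContinuousLinearMap.adjoint_inner_left, h2]

lemma featCov_apply (M : MDP X A) (φ : X → A → Vec d) (πB : Policy X A) (u : Vec d) :
    Matrix.toEuclideanCLM (𝕜 := ℝ) (M.featCov φ πB) u =
      ∑ x, ∑ a, (M.occ πB x a * ⟪φ x a, u⟫) • φ x a := by
  ext i
  simp only [Matrix.ofLp_toEuclideanCLM, Matrix.mulVec, dotProduct, MDP.featCov, Matrix.of_apply,
    WithLp.ofLp_sum, Finset.sum_apply, WithLp.ofLp_smul, Pi.smul_apply, smul_eq_mul,
    PiLp.inner_apply, RCLike.inner_apply, conj_trivial, Finset.sum_mul, Finset.mul_sum]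
  rw [Finset.sum_comm]
  refine Finset.sum_congr rfl fun x _ => ?_
  rw [Finset.sum_comm]
  refine Finset.sum_congr rfl fun a _ => Finset.sum_congr rfl fun j _ => ?_
  ring

lemma inner_featCov_apply (M : MDP X A) (φ : X → A → Vec d) (πB : Policy X A) (u v : Vec d) :
    ⟪v, Matrix.toEuclideanCLM (𝕜 := ℝ) (M.featCov φ πB) u⟫ =
      ∑ x, ∑ a, M.occ πB x a * (⟪φ x a, u⟫ * ⟪φ x a, v⟫) := by
  simp only [featCov_apply, inner_sum, real_inner_smul_right, mul_assoc]
  simp only [real_inner_comm v]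

lemma featCov_posSemidef (M : MDP X A) (φ : X → A → Vec d) (πB : Policy X A) :
    (M.featCov φ πB).PosSemidef := by
  refine Matrix.PosSemidef.of_dotProduct_mulVec_nonneg ?_ fun v => ?_
  · ext i j
    simp [MDP.featCov, mul_comm]
  · have h := inner_featCov_apply M φ πB (WithLp.toLp 2 v) (WithLp.toLp 2 v)
    rw [Matrix.inner_toEuclideanCLM] at h
    have h2 : star v ⬝ᵥ (M.featCov φ πB).mulVec v =
        ∑ x, ∑ a, M.occ πB x a * (⟪φ x a, WithLp.toLp 2 v⟫ * ⟪φ x a, WithLp.toLp 2 v⟫) := by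
      rw [← h]; simp
    rw [h2]
    exact Finset.sum_nonneg fun x _ => Finset.sum_nonneg fun a _ =>
      mul_nonneg (M.occ_nonneg πB x a) (mul_self_nonneg _)

lemma featCov_posDef {M : MDP X A} {φ : X → A → Vec d} {πB : Policy X A}
    (h : IsUnit (M.featCov φ πB)) : (M.featCov φ πB).PosDef :=
  (featCov_posSemidef M φ πB).posDef_iff_isUnit.2 h

variable {M : MDP X A} {φ : X → A → Vec d} {πB : Policy X A}

/-- The left side is the quadratic form of Λ at Λ^{c-1}β, and the exponents add to 2(c-1) + 1. This
is the source of ‖Λ‖^{2c-1} in G_θ². -/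
lemma sum_occ_inner_sq (hL : (M.featCov φ πB).PosDef) (c : ℝ) (β : Vec d) :
    ∑ x, ∑ a, M.occ πB x a * ⟪φ x a, powApply (M.featCov φ πB) (c - 1) β⟫ ^ 2 =
      ⟪β, powApply (M.featCov φ πB) (2 * c - 1) β⟫ := by
  simp only [sq]
  rw [← inner_featCov_apply, ← powApply_one hL, powApply_powApply hL, inner_powApply_left,
    powApply_powApply hL]
  ring_nf

/-- For the two admissible c the power Λ^{2c-1} is the identity or Λ itself, so no general estimate
for powers is needed. -/
lemma inner_powApply_le (hL : (M.featCov φ πB).PosDef) {c : ℝ} (hc : c = 1 / 2 ∨ c = 1)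
    (β : Vec d) :
    ⟪β, powApply (M.featCov φ πB) (2 * c - 1) β⟫ ≤
      opNorm (M.featCov φ πB) ^ (2 * c - 1) * ‖β‖ ^ 2 := by
  rcases hc with rfl | rfl
  · norm_num [powApply_zero hL]
  · have h : (2 * 1 - 1 : ℝ) = 1 := by norm_num
    rw [h, Real.rpow_one, powApply_one hL]
    calc _ ≤ ‖β‖ * ‖Matrix.toEuclideanCLM (𝕜 := ℝ) (M.featCov φ πB) β‖ := real_inner_le_norm _ _
      _ ≤ ‖β‖ * (opNorm (M.featCov φ πB) * ‖β‖) := by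
        gcongr
        exact ContinuousLinearMap.le_opNorm _ _
      _ = _ := by ring

lemma trace_mul_featCov (M : MDP X A) (φ : X → A → Vec d) (πB : Policy X A)
    (N : Matrix (Fin d) (Fin d) ℝ) :
    (N * M.featCov φ πB).trace =
      ∑ x, ∑ a, M.occ πB x a * ⟪φ x a, Matrix.toEuclideanCLM (𝕜 := ℝ) N (φ x a)⟫ := by
  simp only [Matrix.trace, Matrix.diag, Matrix.mul_apply, MDP.featCov, Matrix.of_apply,
    PiLp.inner_apply, RCLike.inner_apply, conj_trivial, Matrix.ofLp_toEuclideanCLM, Matrix.mulVec,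
    dotProduct, Finset.mul_sum, Finset.sum_mul]
  refine ((Finset.sum_congr rfl fun i _ => Finset.sum_comm).trans Finset.sum_comm).trans ?_
  refine Finset.sum_congr rfl fun x _ => ?_
  refine ((Finset.sum_congr rfl fun i _ => Finset.sum_comm).trans Finset.sum_comm).trans ?_
  refine Finset.sum_congr rfl fun a _ => Finset.sum_congr rfl fun i _ =>
    Finset.sum_congr rfl fun j _ => ?_
  ring

/-- Since E‖Λ^{c-1}φ‖² = E⟨φ, Λ^{2c-2}φ⟩ = Tr(Λ^{2c-2}Λ), the trace enters G_β² here. -/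
lemma sum_occ_norm_powApply_sq (hL : (M.featCov φ πB).PosDef) (c : ℝ) :
    ∑ x, ∑ a, M.occ πB x a * ‖powApply (M.featCov φ πB) (c - 1) (φ x a)‖ ^ 2 =
      (matPow (M.featCov φ πB) (2 * c - 1)).trace := by
  have h : matPow (M.featCov φ πB) (2 * c - 1) =
      matPow (M.featCov φ πB) (c - 1 + (c - 1)) * M.featCov φ πB := by
    have h1 := matPow_mul hL (c - 1 + (c - 1)) 1
    rw [matPow_one hL] at h1
    rw [h1]
    ring_nf
  rw [h, trace_mul_featCov]
  refine Finset.sum_congr rfl fun x _ => Finset.sum_congr rfl fun a _ => ?_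
  rw [← real_inner_self_eq_norm_sq, inner_powApply_left, powApply_powApply hL]
  rfl

/-- The mean feature vector `E_{μ^π}[φ]`. -/
noncomputable def meanFeat (M : MDP X A) (φ : X → A → Vec d) (π : Policy X A) : Vec d :=
  ∑ x, ∑ a, M.occ π x a • φ x a

lemma inner_meanFeat (M : MDP X A) (φ : X → A → Vec d) (π : Policy X A) (z : Vec d) :
    ⟪meanFeat M φ π, z⟫ = ∑ x, ∑ a, M.occ π x a * ⟪φ x a, z⟫ := by
  simp only [meanFeat, sum_inner, real_inner_smul_left]

/-- Identifies the coverage ratio with ‖β*‖², so that the coverage assumption says exactly that β*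
is feasible. -/
lemma coverage_eq (hL : (M.featCov φ πB).PosDef) (c : ℝ) (πs : Policy X A) :
    coverage M φ c πs πB = ‖powApply (M.featCov φ πB) (-c) (meanFeat M φ πs)‖ ^ 2 := by
  rw [← real_inner_self_eq_norm_sq, inner_powApply_left, powApply_powApply hL, coverage, meanFeat]
  ring_nf

set_option linter.unusedSectionVars false in
/-- In a linear MDP some vector has inner product `1` with every feature. -/
lemma exists_inner_eq_one (h : M.IsLinear φ) : ∃ u : Vec d, ∀ x a, ⟪φ x a, u⟫ = 1 := by
  obtain ⟨ψ, ω, -, hp⟩ := h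
  refine ⟨∑ y, ψ y, fun x a => ?_⟩
  rw [inner_sum, ← M.p_sum x a]
  exact Finset.sum_congr rfl fun y _ => (hp x a y).symm

/-- Take u with ⟨φ, u⟩ = 1 on all features and let m be the mean feature of the comparator. Then 1 =
⟨m, u⟩ = ⟨Λ^{-c}m, Λ^c u⟩, and Cauchy–Schwarz applies; the second factor is controlled because
‖Λ^{1/2}u‖² = E⟨φ, u⟩² = 1. -/
lemma one_le_coverage_mul (h : M.IsLinear φ) (hL : (M.featCov φ πB).PosDef) {c : ℝ}
    (hc : c = 1 / 2 ∨ c = 1) (πs : Policy X A) :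
    1 ≤ coverage M φ c πs πB * opNorm (M.featCov φ πB) ^ (2 * c - 1) := by
  obtain ⟨u, hu⟩ := exists_inner_eq_one h
  set L := M.featCov φ πB with hLdef
  have h1 : ‖powApply L (1 / 2) u‖ ^ 2 = 1 := by
    rw [← real_inner_self_eq_norm_sq, inner_powApply_left, powApply_powApply hL, add_halves,
      powApply_one hL, hLdef, inner_featCov_apply]
    simp [hu, M.sum_occ]
  have h2 : ‖powApply L c u‖ ^ 2 ≤ opNorm L ^ (2 * c - 1) := by
    have h3 := inner_powApply_le hL hc (powApply L (1 / 2) u)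
    rw [h1, mul_one, powApply_powApply hL, inner_powApply_left, powApply_powApply hL] at h3
    rwa [← real_inner_self_eq_norm_sq, inner_powApply_left, powApply_powApply hL,
      show c + c = 1 / 2 + (2 * c - 1 + 1 / 2) by ring]
  have h4 : ⟪powApply L (-c) (meanFeat M φ πs), powApply L c u⟫ = 1 := by
    rw [inner_powApply_left, powApply_powApply hL, neg_add_cancel, powApply_zero hL,
      inner_meanFeat]
    simp [hu, M.sum_occ]
  have h5 := real_inner_le_norm (powApply L (-c) (meanFeat M φ πs)) (powApply L c u)
  rw [h4] at h5
  rw [coverage_eq hL]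
  calc (1 : ℝ) ≤ (‖powApply L (-c) (meanFeat M φ πs)‖ * ‖powApply L c u‖) ^ 2 :=
        one_le_pow₀ h5
    _ = ‖powApply L (-c) (meanFeat M φ πs)‖ ^ 2 * ‖powApply L c u‖ ^ 2 := mul_pow _ _ _
    _ ≤ _ := by gcongr

lemma trace_featCov (M : MDP X A) (φ : X → A → Vec d) (πB : Policy X A) :
    (M.featCov φ πB).trace = ∑ x, ∑ a, M.occ πB x a * ‖φ x a‖ ^ 2 := by
  rw [← one_mul (M.featCov φ πB), trace_mul_featCov, map_one]
  simp only [← real_inner_self_eq_norm_sq]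
  rfl

/-- Λ is an average of the rank-one maps u ↦ ⟨φ, u⟩φ, each of norm at most ‖φ‖², and the average of
‖φ‖² is the trace. -/
lemma opNorm_featCov_le_trace (M : MDP X A) (φ : X → A → Vec d) (πB : Policy X A) :
    opNorm (M.featCov φ πB) ≤ (M.featCov φ πB).trace := by
  have h0 : 0 ≤ (M.featCov φ πB).trace := by
    rw [trace_featCov]
    exact Finset.sum_nonneg fun x _ => Finset.sum_nonneg fun a _ =>
      mul_nonneg (M.occ_nonneg πB x a) (sq_nonneg _)
  refine ContinuousLinearMap.opNorm_le_bound _ h0 fun u => ?_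
  rw [featCov_apply, trace_featCov, Finset.sum_mul]
  refine norm_sum_le_of_le _ fun x _ => ?_
  rw [Finset.sum_mul]
  refine norm_sum_le_of_le _ fun a _ => ?_
  rw [norm_smul, Real.norm_eq_abs, abs_mul, abs_of_nonneg (M.occ_nonneg πB x a)]
  have := abs_real_inner_le_norm (φ x a) u
  calc M.occ πB x a * |⟪φ x a, u⟫| * ‖φ x a‖ ≤ M.occ πB x a * (‖φ x a‖ * ‖u‖) * ‖φ x a‖ := by
        gcongr
        exact M.occ_nonneg πB x a
    _ = _ := by ring

lemma trace_featCov_le {Dφ : ℝ} (hφ : ∀ x a, ‖φ x a‖ ≤ Dφ) :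
    (M.featCov φ πB).trace ≤ Dφ ^ 2 := by
  rw [trace_featCov, ← one_mul (Dφ ^ 2), ← M.sum_occ πB, Finset.sum_mul]
  refine Finset.sum_le_sum fun x _ => ?_
  rw [Finset.sum_mul]
  refine Finset.sum_le_sum fun a _ => ?_
  have := M.occ_nonneg πB x a
  have := hφ x a
  gcongr

end Covariance

/-! ### Projected gradient steps and exponential weights -/

section Optimization

variable {d : ℕ}

lemma norm_projBall_le {D : ℝ} (hD : 0 ≤ D) (v : Vec d) : ‖projBall D v‖ ≤ D := by
  unfold projBall
  split_ifs with h
  · exact h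
  · push Not at h
    have hv : 0 < ‖v‖ := hD.trans_lt h
    rw [norm_smul, Real.norm_eq_abs, abs_of_nonneg (div_nonneg hD hv.le),
      div_mul_cancel₀ _ hv.ne']

/-- Outside the ball put s = D/‖v‖ < 1. Cauchy–Schwarz gives ⟨v, u⟩ ≤ s‖v‖², and expanding shows
that the squared distance drops by at least (1-s)²‖v‖². -/
lemma norm_projBall_sub_sq_le {D : ℝ} {u : Vec d} (hu : ‖u‖ ≤ D) (v : Vec d) :
    ‖projBall D v - u‖ ^ 2 ≤ ‖v - u‖ ^ 2 := by
  unfold projBall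
  split_ifs with h
  · exact le_rfl
  · push Not at h
    have hD : 0 ≤ D := (norm_nonneg u).trans hu
    have hv : 0 < ‖v‖ := hD.trans_lt h
    set s := D / ‖v‖ with hs
    have hs0 : 0 ≤ s := div_nonneg hD hv.le
    have hs1 : s ≤ 1 := (div_le_one hv).2 h.le
    have hDs : D = s * ‖v‖ := (div_mul_cancel₀ _ hv.ne').symm
    have hi : ⟪v, u⟫ ≤ s * ‖v‖ ^ 2 := by
      calc ⟪v, u⟫ ≤ ‖v‖ * ‖u‖ := real_inner_le_norm v u
        _ ≤ ‖v‖ * D := by gcongr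
        _ = s * ‖v‖ ^ 2 := by rw [hDs]; ring
    rw [norm_sub_sq_real, norm_sub_sq_real, norm_smul, real_inner_smul_left, Real.norm_eq_abs,
      abs_of_nonneg hs0, mul_pow]
    nlinarith [mul_le_mul_of_nonneg_left hi (sub_nonneg.2 hs1),
      mul_nonneg (mul_self_nonneg (1 - s)) (sq_nonneg ‖v‖)]

/-- One step of projected gradient descent. -/
lemma projBall_step {D : ℝ} {u : Vec d} (hu : ‖u‖ ≤ D) (v g : Vec d) (η : ℝ) :
    ‖projBall D (v - η • g) - u‖ ^ 2 ≤
      ‖v - u‖ ^ 2 - 2 * η * ⟪g, v - u⟫ + η ^ 2 * ‖g‖ ^ 2 := by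
  refine (norm_projBall_sub_sq_le hu _).trans_eq ?_
  rw [show v - η • g - u = (v - u) - η • g by abel, norm_sub_sq_real, norm_smul,
    real_inner_smul_right, mul_pow, Real.norm_eq_abs, sq_abs, real_inner_comm]
  ring

/-- Hoeffding's lemma for a finitely supported distribution. -/
lemma sum_mul_exp_le {A : Type*} [Fintype A] {p u : A → ℝ} (hp : ∀ a, 0 ≤ p a)
    (hp1 : ∑ a, p a = 1) {B : ℝ} (hu : ∀ a, |u a| ≤ B) :
    ∑ a, p a * Real.exp (u a) ≤ Real.exp (∑ a, p a * u a + B ^ 2 / 2) := by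
  let : MeasurableSpace A := ⊤
  set μ : Measure A := ∑ a, ENNReal.ofReal (p a) • Measure.dirac a with hμ
  have hreal : ∀ f : A → ℝ, ∫ a, f a ∂μ = ∑ a, p a * f a := by
    intro f
    rw [hμ, integral_finsetSum_measure]
    · refine Finset.sum_congr rfl fun a _ => ?_
      rw [integral_smul_measure, integral_dirac, ENNReal.toReal_ofReal (hp a), smul_eq_mul]
    · intro a _
      exact (integrable_dirac (by simp)).smul_measure ENNReal.ofReal_ne_top
  have : IsProbabilityMeasure μ := by
    refine ⟨?_⟩
    simp only [hμ, Measure.coe_finsetSum, Finset.sum_apply, Measure.smul_apply, measure_univ,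
      smul_eq_mul, mul_one]
    rw [← ENNReal.ofReal_sum_of_nonneg fun a _ => hp a, hp1, ENNReal.ofReal_one]
  have h := (hasSubgaussianMGF_of_mem_Icc (μ := μ) (X := u) (a := -B) (b := B)
    (measurable_from_top.aemeasurable)
    (Filter.Eventually.of_forall fun a => abs_le.1 (hu a))).mgf_le 1
  rw [mgf, hreal, hreal] at h
  -- A variable in [-B, B] has range 2B, so its variance proxy is B².
  have h2 : ((‖B - -B‖₊ / 2 : NNReal) ^ 2 : NNReal) = (B ^ 2 : ℝ) := by
    push_cast
    rw [Real.norm_eq_abs, div_pow, sq_abs]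
    ring
  rw [h2] at h
  simp only [one_mul, one_pow, mul_one, Real.exp_sub, mul_div_assoc'] at h
  rw [← Finset.sum_div, div_le_iff₀ (Real.exp_pos _), ← Real.exp_add] at h
  rwa [add_comm (B ^ 2 / 2)] at h

/-- Regret bound for exponential weights. -/
lemma exp_weights_regret {A : Type*} [Fintype A] [Nonempty A] {u : ℕ → A → ℝ} {B α : ℝ}
    (hα : 0 < α) (hu : ∀ t a, |u t a| ≤ B) {p : A → ℝ} (hp : ∀ a, 0 ≤ p a)
    (hp1 : ∑ a, p a = 1) (T : ℕ) :
    ∑ t ∈ Finset.range T, ∑ a, (p a - Real.exp (α * ∑ i ∈ Finset.range t, u i a) /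
        ∑ b, Real.exp (α * ∑ i ∈ Finset.range t, u i b)) * u t a ≤
      Real.log (Fintype.card A) / α + T * (α * B ^ 2 / 2) := by
  set Z : ℕ → ℝ := fun t => ∑ b, Real.exp (α * ∑ i ∈ Finset.range t, u i b) with hZ
  have hZpos : ∀ t, 0 < Z t := fun t =>
    Finset.sum_pos (fun b _ => Real.exp_pos _) Finset.univ_nonempty
  set π : ℕ → A → ℝ := fun t a => Real.exp (α * ∑ i ∈ Finset.range t, u i a) / Z t with hπ
  -- The potential is log Z. The ratio Z(t+1)/Z(t) is the exponential moment of αu_t under π_t,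
  -- which Hoeffding's lemma bounds.
  have hstep : ∀ t, Real.log (Z (t + 1)) ≤
      Real.log (Z t) + (α * ∑ a, π t a * u t a + α ^ 2 * B ^ 2 / 2) := by
    intro t
    have h1 := sum_mul_exp_le (p := π t) (u := fun a => α * u t a) (B := α * B)
      (fun a => div_nonneg (Real.exp_pos _).le (hZpos t).le)
      (by simp only [hπ, ← Finset.sum_div]; exact div_self (hZpos t).ne')
      (fun a => by rw [abs_mul, abs_of_pos hα]; exact mul_le_mul_of_nonneg_left (hu t a) hα.le)
    have h2 : Z (t + 1) = Z t * ∑ a, π t a * Real.exp (α * u t a) := by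
      rw [Finset.mul_sum]
      refine Finset.sum_congr rfl fun a _ => ?_
      rw [Finset.sum_range_succ, mul_add, Real.exp_add, ← mul_assoc]
      exact congrArg (· * _) (mul_div_cancel₀ _ (hZpos t).ne').symm
    have h3 : 0 < ∑ a, π t a * Real.exp (α * u t a) :=
      Finset.sum_pos (fun a _ => mul_pos (div_pos (Real.exp_pos _) (hZpos t)) (Real.exp_pos _))
        Finset.univ_nonempty
    rw [h2, Real.log_mul (hZpos t).ne' h3.ne']
    refine add_le_add le_rfl ((Real.log_le_iff_le_exp h3).2 (h1.trans_eq ?_))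
    rw [mul_pow, Finset.mul_sum]
    congr 2
    exact Finset.sum_congr rfl fun a _ => by ring
  have hup : ∀ t, Real.log (Z t) ≤ Real.log (Fintype.card A) +
      ∑ i ∈ Finset.range t, (α * ∑ a, π i a * u i a + α ^ 2 * B ^ 2 / 2) := by
    intro t
    induction t with
    | zero => simp [hZ]
    | succ t ih =>
      rw [Finset.sum_range_succ]
      linarith [hstep t]
  -- Z dominates each of its summands, hence log Z dominates every p-average of the exponents.
  have hlow : α * ∑ t ∈ Finset.range T, ∑ a, p a * u t a ≤ Real.log (Z T) := by
    have h1 : ∀ a, α * ∑ i ∈ Finset.range T, u i a ≤ Real.log (Z T) := fun a => by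
      rw [Real.le_log_iff_exp_le (hZpos T)]
      exact Finset.single_le_sum (f := fun b => Real.exp (α * ∑ i ∈ Finset.range T, u i b))
        (fun b _ => (Real.exp_pos _).le) (Finset.mem_univ a)
    calc α * ∑ t ∈ Finset.range T, ∑ a, p a * u t a
        = ∑ a, p a * (α * ∑ i ∈ Finset.range T, u i a) := by
          rw [Finset.sum_comm, Finset.mul_sum]
          refine Finset.sum_congr rfl fun a _ => ?_
          rw [← Finset.mul_sum]
          ring
      _ ≤ ∑ a, p a * Real.log (Z T) :=
          Finset.sum_le_sum fun a _ => mul_le_mul_of_nonneg_left (h1 a) (hp a)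
      _ = Real.log (Z T) := by rw [← Finset.sum_mul, hp1, one_mul]
  have h := hlow.trans (hup T)
  rw [Finset.sum_add_distrib, ← Finset.mul_sum, Finset.sum_const, Finset.card_range,
    nsmul_eq_mul] at h
  simp only [sub_mul, Finset.sum_sub_distrib]
  rw [← mul_le_mul_iff_right₀ hα, mul_sub, mul_add, mul_div_cancel₀ _ hα.ne']
  linarith

end Optimization

/-! ### Expectations over the data -/

section Data

instance {X A : Type*} : DiscreteMeasurableSpace (Sample X A) := ⟨fun _ => trivial⟩

instance {X A : Type*} [Finite X] [Finite A] : Finite (Sample X A) :=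
  Finite.of_injective (fun s : Sample X A => (s.x0, s.x, s.a, s.xnext)) fun s s' h => by
    cases s; cases s'; simpa using h

variable {Ω : Type*} [MeasurableSpace Ω] {P : Measure Ω} [IsProbabilityMeasure P]

lemma integrable_comp_of_finite {E : Type*} [MeasurableSpace E] [DiscreteMeasurableSpace E]
    [Finite E] {Y : Ω → E} (hY : Measurable Y) (f : E → ℝ) : Integrable (fun ω => f (Y ω)) P := by
  have := Measure.isProbabilityMeasure_map (μ := P) hY.aemeasurable
  exact (Integrable.of_finite (μ := P.map Y) (f := f)).comp_measurable hY

lemma integral_comp_of_finite {E : Type*} [Fintype E] {Y : Ω → E}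
    (hY : ∀ e, MeasurableSet {ω | Y ω = e}) (f : E → ℝ) :
    ∫ ω, f (Y ω) ∂P = ∑ e, P.real {ω | Y ω = e} * f e := by
  let : MeasurableSpace E := ⊤
  have hm : Measurable Y := measurable_to_countable' hY
  have := Measure.isProbabilityMeasure_map (μ := P) hm.aemeasurable
  rw [← integral_map (μ := P) hm.aemeasurable (f := f) measurable_from_top.aestronglyMeasurable,
    integral_fintype Integrable.of_finite]
  refine Finset.sum_congr rfl fun e _ => ?_
  rw [map_measureReal_apply hm trivial, smul_eq_mul]
  rfl

/-- Independent variables can be integrated one after the other. -/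
lemma integral_comp_of_indepFun {E F : Type*} [MeasurableSpace E] [DiscreteMeasurableSpace E]
    [Finite E] [MeasurableSpace F] [DiscreteMeasurableSpace F] [Finite F] {Y : Ω → E} {Z : Ω → F}
    (hY : Measurable Y) (hZ : Measurable Z) (h : IndepFun Y Z P) (f : E → F → ℝ) :
    ∫ ω, f (Y ω) (Z ω) ∂P = ∫ ω, ∫ ω', f (Y ω) (Z ω') ∂P ∂P := by
  have := Measure.isProbabilityMeasure_map (μ := P) hY.aemeasurable
  have := Measure.isProbabilityMeasure_map (μ := P) hZ.aemeasurable
  have h1 : ∫ ω, f (Y ω) (Z ω) ∂P =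
      ∫ z, f z.1 z.2 ∂(P.map fun ω => (Y ω, Z ω)) :=
    (integral_map (hY.prodMk hZ).aemeasurable
      (Measurable.of_discrete (f := fun z : E × F => f z.1 z.2)).aestronglyMeasurable).symm
  rw [h1, (indepFun_iff_map_prod_eq_prod_map_map hY.aemeasurable hZ.aemeasurable).1 h,
    integral_prod (fun z : E × F => f z.1 z.2) Integrable.of_finite,
    integral_map hY.aemeasurable Measurable.of_discrete.aestronglyMeasurable]
  refine integral_congr_ae (Filter.Eventually.of_forall fun ω => ?_)
  exact integral_map hZ.aemeasurable Measurable.of_discrete.aestronglyMeasurable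

variable {X A : Type*} [Fintype X] [Fintype A] {M : MDP X A} {πB : Policy X A} {n : ℕ}
  {W : ℕ → Ω → Sample X A}

/-- Extension of a finite segment of data by a constant. -/
def extendData {S : Type*} (s₀ : S) (n : ℕ) (g : Fin n → S) (j : ℕ) : S :=
  if h : j < n then g ⟨j, h⟩ else s₀

/-- Turns a function of a data sequence into one of a finite segment. Segments range over a finite
type, so integrability comes for free. -/
lemma DependsOn.eq_extendData {S β : Type*} {f : (ℕ → S) → β} {n : ℕ}
    (hf : DependsOn f (Set.Iio n)) (s₀ : S) (w : ℕ → S) :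
    f w = f (extendData s₀ n fun j => w j) :=
  hf fun j hj => by simp [extendData, Set.mem_Iio.1 hj]

set_option linter.unusedSectionVars false in
lemma IsDataset.measurable_segment (h : IsDataset M πB P n W) {m : ℕ} (hm : m ≤ n) :
    Measurable fun ω (j : Fin m) => W j ω :=
  measurable_pi_lambda _ fun j => h.measurable j (j.2.trans_le hm)

lemma IsDataset.integrable (h : IsDataset M πB P n W) {m : ℕ} (hm : m ≤ n)
    {f : (ℕ → Sample X A) → ℝ} (hf : DependsOn f (Set.Iio m)) :
    Integrable (fun ω => f fun i => W i ω) P := by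
  have : Nonempty Ω := P.nonempty_of_neZero
  let s₀ : Sample X A := W 0 (Classical.arbitrary Ω)
  have he : (fun ω => f fun i => W i ω) =
      fun ω => f (extendData s₀ m fun j : Fin m => W j ω) :=
    funext fun ω => DependsOn.eq_extendData hf s₀ _
  rw [he]
  exact integrable_comp_of_finite (h.measurable_segment hm) (fun g => f (extendData s₀ m g))

/-- A fresh observation can be averaged out first. -/
lemma IsDataset.integral_fresh (h : IsDataset M πB P n W) {i : ℕ} (hi : i < n)
    {f : (ℕ → Sample X A) → Sample X A → ℝ} (hf : ∀ s, DependsOn (fun w => f w s) (Set.Iio i)) :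
    ∫ ω, f (fun j => W j ω) (W i ω) ∂P =
      ∫ ω, ∫ ω', f (fun j => W j ω) (W i ω') ∂P ∂P := by
  have : Nonempty Ω := P.nonempty_of_neZero
  let s₀ : Sample X A := W 0 (Classical.arbitrary Ω)
  -- Group the independent family into the observations before i and the single observation i.
  have hind : IndepFun (fun ω (j : Fin i) => W j ω) (W i) P := by
    classical
    have h1 := h.indep.indepFun_finset (Finset.univ.filter fun j : Fin n => j.1 < i) {⟨i, hi⟩}
      (by simp) (fun j => h.measurable j j.2)
    refine h1.comp (φ := fun g (j : Fin i) => g ⟨⟨j, j.2.trans hi⟩, by simp⟩)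
      (ψ := fun g => g ⟨⟨i, hi⟩, by simp⟩) ?_ ?_
    · exact measurable_pi_lambda _ fun j => measurable_pi_apply _
    · exact measurable_pi_apply _
  have hfe : ∀ ω s, f (fun j => W j ω) s = f (extendData s₀ i fun j : Fin i => W j ω) s :=
    fun ω s => DependsOn.eq_extendData (hf s) s₀ _
  have := integral_comp_of_indepFun (P := P) (h.measurable_segment hi.le) (h.measurable i hi) hind
    (fun g s => f (extendData s₀ i g) s)
  simp only [hfe]
  exact this

/-- If averaging out a fresh observation gives at most `g`, the expectation is at most that
of `g`. -/
lemma IsDataset.integral_fresh_le (h : IsDataset M πB P n W) {i : ℕ} (hi : i < n)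
    {f : (ℕ → Sample X A) → Sample X A → ℝ} {g : (ℕ → Sample X A) → ℝ}
    (hf : ∀ s, DependsOn (fun w => f w s) (Set.Iio i)) (hg : DependsOn g (Set.Iio i))
    (hfg : ∀ w, ∫ ω, f w (W i ω) ∂P ≤ g w) :
    ∫ ω, f (fun j => W j ω) (W i ω) ∂P ≤ ∫ ω, g (fun j => W j ω) ∂P := by
  rw [h.integral_fresh hi hf]
  refine integral_mono (h.integrable (m := i) hi.le
    (f := fun w => ∫ ω', f w (W i ω') ∂P) fun w w' hw => ?_) (h.integrable hi.le hg)
    fun ω => hfg _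
  exact integral_congr_ae (Filter.Eventually.of_forall fun ω' => hf _ hw)

lemma IsDataset.integrable_sample (h : IsDataset M πB P n W) {i : ℕ} (hi : i < n)
    (f : Sample X A → ℝ) : Integrable (fun ω => f (W i ω)) P :=
  integrable_comp_of_finite (h.measurable i hi) f

lemma IsDataset.integral_init (h : IsDataset M πB P n W) {i : ℕ} (hi : i < n) (f : X → ℝ) :
    ∫ ω, f (W i ω).x0 ∂P = ∑ x, M.ν₀ x * f x := by
  rw [integral_comp_of_finite (Y := fun ω => (W i ω).x0)
    (fun e => h.measurable i hi (t := {s | s.x0 = e}) trivial)]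
  simp only [h.law_init i hi]

lemma IsDataset.integral_trans (h : IsDataset M πB P n W) {i : ℕ} (hi : i < n)
    (f : X → A → X → ℝ) :
    ∫ ω, f (W i ω).x (W i ω).a (W i ω).xnext ∂P =
      ∑ x, ∑ a, M.occ πB x a * ∑ y, M.p x a y * f x a y := by
  rw [integral_comp_of_finite (Y := fun ω => ((W i ω).x, (W i ω).a, (W i ω).xnext))
    (f := fun z => f z.1 z.2.1 z.2.2)
    (fun e => h.measurable i hi (t := {s | (s.x, s.a, s.xnext) = e}) trivial)]
  simp only [Fintype.sum_prod_type, Prod.mk.injEq, h.law_trans i hi, Finset.mul_sum, mul_assoc]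

lemma IsDataset.integral_pair (h : IsDataset M πB P n W) {i : ℕ} (hi : i < n)
    (f : X → A → ℝ) :
    ∫ ω, f (W i ω).x (W i ω).a ∂P = ∑ x, ∑ a, M.occ πB x a * f x a := by
  rw [h.integral_trans hi (fun x a _ => f x a)]
  simp only [← Finset.sum_mul, M.p_sum, one_mul]

/-- A uniform index independent of the data averages over the iterations. -/
lemma IsUniformIndex.integral_eq (h : IsDataset M πB P n W) {T : ℕ} {J : Ω → Fin T}
    (hJ : IsUniformIndex P n W J) {f : ℕ → (ℕ → Sample X A) → ℝ}
    (hf : ∀ t < T, DependsOn (f t) (Set.Iio n)) :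
    ∫ ω, f (J ω) (fun i => W i ω) ∂P =
      1 / T * ∑ t ∈ Finset.range T, ∫ ω, f t (fun i => W i ω) ∂P := by
  have : Nonempty Ω := P.nonempty_of_neZero
  let s₀ : Sample X A := W 0 (Classical.arbitrary Ω)
  have hfe : ∀ (j : Fin T) ω, f j (fun i => W i ω) = f j (extendData s₀ n fun i : Fin n => W i ω) :=
    fun j ω => DependsOn.eq_extendData (hf j j.2) s₀ _
  have h1 := integral_comp_of_indepFun (P := P) hJ.measurable (h.measurable_segment le_rfl)
    hJ.indep (fun j g => f j (extendData s₀ n g))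
  simp only [← hfe] at h1
  rw [h1, integral_comp_of_finite (Y := J) (fun e => hJ.measurable (MeasurableSet.singleton e))
    (f := fun j => ∫ ω', f j (fun i => W i ω') ∂P)]
  simp only [hJ.law, ← Finset.mul_sum]
  rw [Finset.sum_range]

end Data

/-! ### Mean gradients and the decomposition of the suboptimality -/

section Gradients

variable {X A : Type*} [Fintype X] [Fintype A] {d : ℕ}

/-- The state values `v(x) = ∑_a π(a | x) ⟨φ(x, a), θ⟩`. -/
noncomputable def linValue (φ : X → A → Vec d) (π : Policy X A) (θ : Vec d) (x : X) : ℝ :=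
  ∑ a, π.prob x a * ⟪φ x a, θ⟫

/-- The expectation of `gradβ` over one observation. -/
noncomputable def meanGradβ (M : MDP X A) (φ : X → A → Vec d) (πB : Policy X A) (c : ℝ)
    (π : Policy X A) (θ : Vec d) : Vec d :=
  ∑ x, ∑ a, (M.occ πB x a *
    (M.r x a + M.γ * ∑ y, M.p x a y * linValue φ π θ y - ⟪φ x a, θ⟫)) •
      powApply (M.featCov φ πB) (c - 1) (φ x a)

/-- The expectation of `gradθ` over one observation. -/
noncomputable def meanGradθ (M : MDP X A) (φ : X → A → Vec d) (πB : Policy X A) (c : ℝ)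
    (π : Policy X A) (β : Vec d) : Vec d :=
  ((1 - M.γ) • ∑ x, M.ν₀ x • ∑ a, π.prob x a • φ x a) +
    ∑ x, ∑ a, (M.occ πB x a * ⟪φ x a, powApply (M.featCov φ πB) (c - 1) β⟫) •
      ((M.γ • ∑ y, M.p x a y • ∑ b, π.prob y b • φ y b) - φ x a)

variable (M : MDP X A) (φ : X → A → Vec d) (πB : Policy X A) (c : ℝ)

lemma inner_meanGradβ (π : Policy X A) (θ u : Vec d) :
    ⟪meanGradβ M φ πB c π θ, u⟫ = ∑ x, ∑ a, M.occ πB x a *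
      ((M.r x a + M.γ * ∑ y, M.p x a y * linValue φ π θ y - ⟪φ x a, θ⟫) *
        ⟪φ x a, powApply (M.featCov φ πB) (c - 1) u⟫) := by
  simp only [meanGradβ, sum_inner, real_inner_smul_left, inner_powApply_left, mul_assoc]

lemma inner_meanGradθ (π : Policy X A) (β u : Vec d) :
    ⟪meanGradθ M φ πB c π β, u⟫ = (1 - M.γ) * ∑ x, M.ν₀ x * linValue φ π u x +
      ∑ x, ∑ a, M.occ πB x a * (⟪φ x a, powApply (M.featCov φ πB) (c - 1) β⟫ *
        (M.γ * ∑ y, M.p x a y * linValue φ π u y - ⟪φ x a, u⟫)) := by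
  simp only [meanGradθ, linValue, inner_add_left, inner_sub_left, sum_inner, real_inner_smul_left,
    mul_assoc]

variable {M φ πB c}

/-- The suboptimality as a sum of a policy regret and two gradient regrets. -/
lemma subopt_eq (hlin : M.IsLinear φ) (hL : (M.featCov φ πB).PosDef) (πs π : Policy X A)
    {θπ : Vec d} (hθπ : ∀ x a, M.q π x a = ⟪φ x a, θπ⟫) (β θ : Vec d) :
    M.subopt πs π = ∑ x, M.stateOcc πs x * ∑ a, (πs.prob x a - π.prob x a) * ⟪φ x a, θ⟫ +
      ⟪meanGradβ M φ πB c π θ, powApply (M.featCov φ πB) (-c) (meanFeat M φ πs) - β⟫ +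
      ⟪meanGradθ M φ πB c π β, θ - θπ⟫ := by
  obtain ⟨ψ, ω, hr, hp⟩ := hlin
  set B := fun x a => ⟪φ x a, powApply (M.featCov φ πB) (c - 1) β⟫ with hB
  set Pv : Vec d → X → A → ℝ := fun u x a => ∑ y, M.p x a y * linValue φ π u y with hPv
  have hstar : ⟪meanGradβ M φ πB c π θ, powApply (M.featCov φ πB) (-c) (meanFeat M φ πs)⟫ =
      ∑ x, ∑ a, M.occ πs x a * (M.r x a + M.γ * Pv θ x a - ⟪φ x a, θ⟫) := by
    -- Linearity of the MDP makes the Bellman residual a linear function ⟨φ, z⟩ of the features.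
    set z : Vec d := ω + M.γ • ∑ y, linValue φ π θ y • ψ y - θ with hz
    have hδ : ∀ x a, M.r x a + M.γ * Pv θ x a - ⟪φ x a, θ⟫ = ⟪φ x a, z⟫ := by
      intro x a
      simp only [hz, hPv, inner_sub_right, inner_add_right, real_inner_smul_right, inner_sum, hr,
        hp]
      simp only [mul_comm (linValue φ π θ _)]
    rw [inner_meanGradβ]
    simp only [hPv] at hδ
    simp only [hPv, hδ, powApply_powApply hL]
    -- Change of measure: E_{μ_B}[⟨φ, z⟩⟨φ, Λ^{-1}m⟩] = ⟨z, m⟩ with m the mean feature under the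
    -- comparator. The exponent is c - 1 - c = -1 for either c.
    have := inner_featCov_apply M φ πB
      (powApply (M.featCov φ πB) (c - 1 + -c) (meanFeat M φ πs)) z
    rw [← powApply_one hL, powApply_powApply hL, show 1 + (c - 1 + -c) = 0 by ring,
      powApply_zero hL, real_inner_comm, inner_meanFeat] at this
    rw [this]
    simp only [mul_comm]
  -- At θ^π the Bellman residual vanishes pointwise, so the dependence on β disappears.
  have hq : ∑ x, ∑ a, M.occ πB x a * (B x a * (M.γ * Pv θπ x a - ⟪φ x a, θπ⟫)) =
      - ∑ x, ∑ a, M.occ πB x a * (B x a * M.r x a) := by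
    rw [← Finset.sum_neg_distrib]
    refine Finset.sum_congr rfl fun x _ => ?_
    rw [← Finset.sum_neg_distrib]
    refine Finset.sum_congr rfl fun a _ => ?_
    have h1 := M.q_eq π x a
    simp only [hθπ] at h1
    have h2 : M.γ * Pv θπ x a - ⟪φ x a, θπ⟫ = - M.r x a := by
      simp only [hPv, linValue]
      linarith
    rw [h2]
    ring
  have hrew : (1 - M.γ) * ∑ x, M.ν₀ x * linValue φ π θπ x = ∑ x, ∑ a, M.occ π x a * M.r x a := by
    rw [M.sum_occ_mul_reward π]
    simp only [hθπ, linValue]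
  have hβ : ∑ x, ∑ a, M.occ πB x a * ((M.r x a + M.γ * Pv θ x a - ⟪φ x a, θ⟫) * B x a) =
      ∑ x, ∑ a, M.occ πB x a * (B x a * M.r x a) +
        ∑ x, ∑ a, M.occ πB x a * (B x a * (M.γ * Pv θ x a - ⟪φ x a, θ⟫)) := by
    simp only [← Finset.sum_add_distrib]
    refine Finset.sum_congr rfl fun x _ => Finset.sum_congr rfl fun a _ => ?_
    ring
  have hs : ∑ x, ∑ a, M.occ πs x a * (M.r x a + M.γ * Pv θ x a - ⟪φ x a, θ⟫) =
      ∑ x, ∑ a, M.occ πs x a * M.r x a + M.γ * ∑ x, ∑ a, M.occ πs x a * Pv θ x a -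
        ∑ x, ∑ a, M.occ πs x a * ⟪φ x a, θ⟫ := by
    simp only [Finset.mul_sum, ← Finset.sum_add_distrib, ← Finset.sum_sub_distrib]
    refine Finset.sum_congr rfl fun x _ => Finset.sum_congr rfl fun a _ => ?_
    ring
  have hpol : ∑ x, M.stateOcc πs x * ∑ a, (πs.prob x a - π.prob x a) * ⟪φ x a, θ⟫ =
      ∑ x, ∑ a, M.occ πs x a * ⟪φ x a, θ⟫ - ∑ x, M.stateOcc πs x * linValue φ π θ x := by
    simp only [linValue, MDP.occ, Finset.mul_sum, ← Finset.sum_sub_distrib]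
    refine Finset.sum_congr rfl fun x _ => Finset.sum_congr rfl fun a _ => ?_
    ring
  have hflow := M.sum_stateOcc_mul πs (linValue φ π θ)
  rw [inner_sub_right, inner_sub_right, hstar, inner_meanGradβ, inner_meanGradθ, inner_meanGradθ]
  simp only [MDP.subopt, sub_mul, Finset.sum_sub_distrib]
  simp only [hPv, hB, sub_mul, Finset.sum_sub_distrib] at hs hβ hq hpol
  simp only [hPv]
  linarith

set_option linter.unusedSectionVars false in
lemma abs_inner_le {Dφ Dθ : ℝ} (hφ : ∀ x a, ‖φ x a‖ ≤ Dφ) {θ : Vec d} (hθ : ‖θ‖ ≤ Dθ) (x : X)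
    (a : A) : |⟪φ x a, θ⟫| ≤ Dφ * Dθ :=
  (abs_real_inner_le_norm _ _).trans
    (mul_le_mul (hφ x a) hθ (norm_nonneg _) ((norm_nonneg _).trans (hφ x a)))

lemma abs_linValue_le {Dφ Dθ : ℝ} (hφ : ∀ x a, ‖φ x a‖ ≤ Dφ) {θ : Vec d} (hθ : ‖θ‖ ≤ Dθ)
    (π : Policy X A) (x : X) : |linValue φ π θ x| ≤ Dφ * Dθ := by
  calc |linValue φ π θ x| ≤ ∑ a, |π.prob x a * ⟪φ x a, θ⟫| := Finset.abs_sum_le_sum_abs _ _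
    _ ≤ ∑ a, π.prob x a * (Dφ * Dθ) := Finset.sum_le_sum fun a _ => by
        rw [abs_mul, abs_of_nonneg (π.nonneg x a)]
        exact mul_le_mul_of_nonneg_left (abs_inner_le hφ hθ x a) (π.nonneg x a)
    _ = Dφ * Dθ := by rw [← Finset.sum_mul, π.sum_one, one_mul]

set_option linter.unusedSectionVars false in
lemma norm_meanAction_le {Dφ : ℝ} (hφ : ∀ x a, ‖φ x a‖ ≤ Dφ) (π : Policy X A) (x : X) :
    ‖∑ a, π.prob x a • φ x a‖ ≤ Dφ := by
  calc ‖∑ a, π.prob x a • φ x a‖ ≤ ∑ a, π.prob x a * Dφ := norm_sum_le_of_le _ fun a _ => by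
        rw [norm_smul, Real.norm_eq_abs, abs_of_nonneg (π.nonneg x a)]
        exact mul_le_mul_of_nonneg_left (hφ x a) (π.nonneg x a)
    _ = Dφ := by rw [← Finset.sum_mul, π.sum_one, one_mul]

/-- The indicators collapse the sum over states, leaving action averages of features at X⁰ and X'.
Each has norm at most D_φ. -/
lemma gradθ_eq (L : Matrix (Fin d) (Fin d) ℝ) (π : Policy X A) (β : Vec d) (s : Sample X A) :
    gradθ M φ L c π β s = (1 - M.γ) • (∑ a, π.prob s.x0 a • φ s.x0 a) +
      (M.γ * ⟪φ s.x s.a, powApply L (c - 1) β⟫) • (∑ a, π.prob s.xnext a • φ s.xnext a) -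
      ⟪φ s.x s.a, powApply L (c - 1) β⟫ • φ s.x s.a := by
  classical
  have h1 : ∀ x a, muEst M φ L c π β s x a • φ x a =
      (if s.x0 = x then (1 - M.γ) • π.prob x a • φ x a else 0) +
        (if s.xnext = x then (M.γ * ⟪φ s.x s.a, powApply L (c - 1) β⟫) • π.prob x a • φ x a
          else 0) := by
    intro x a
    unfold muEst
    split_ifs <;> simp [smul_smul, ← add_smul] <;> ring_nf
  rw [gradθ]
  congr 1
  simp only [h1, Finset.sum_add_distrib]
  rw [Finset.smul_sum, Finset.smul_sum]
  congr 1
  · rw [Finset.sum_comm]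
    simp
  · rw [Finset.sum_comm]
    simp

lemma add_sq_le_three (a b e : ℝ) : (a + b + e) ^ 2 ≤ 3 * (a ^ 2 + b ^ 2 + e ^ 2) := by
  nlinarith [sq_nonneg (a - b), sq_nonneg (a - e), sq_nonneg (b - e)]

variable {Ω : Type*} [MeasurableSpace Ω] {P : Measure Ω} [IsProbabilityMeasure P] {n : ℕ}
  {W : ℕ → Ω → Sample X A}

lemma IsDataset.integral_inner_gradβ (h : IsDataset M πB P n W) {i : ℕ} (hi : i < n)
    (π : Policy X A) (θ u : Vec d) :
    ∫ ω, ⟪gradβ M φ (M.featCov φ πB) c π θ (W i ω), u⟫ ∂P = ⟪meanGradβ M φ πB c π θ, u⟫ := by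
  simp only [gradβ, real_inner_smul_left, inner_powApply_left]
  rw [h.integral_trans hi (fun x a y => (M.r x a + M.γ * (∑ b, π.prob y b * ⟪φ y b, θ⟫) -
    ⟪φ x a, θ⟫) * ⟪φ x a, powApply (M.featCov φ πB) (c - 1) u⟫), inner_meanGradβ]
  refine Finset.sum_congr rfl fun x _ => Finset.sum_congr rfl fun a _ => ?_
  congr 1
  have : ∀ y, M.p x a y * ((M.r x a + M.γ * (∑ b, π.prob y b * ⟪φ y b, θ⟫) -
      ⟪φ x a, θ⟫) * ⟪φ x a, powApply (M.featCov φ πB) (c - 1) u⟫) =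
      (M.p x a y * (M.r x a - ⟪φ x a, θ⟫) + M.γ * (M.p x a y * linValue φ π θ y)) *
        ⟪φ x a, powApply (M.featCov φ πB) (c - 1) u⟫ := fun y => by
    simp only [linValue]; ring
  simp only [this]
  rw [← Finset.sum_mul, Finset.sum_add_distrib, ← Finset.sum_mul, M.p_sum, ← Finset.mul_sum]
  ring

/-- The integrand is a function of X⁰ plus a function of (X, A, X'), so the two marginal laws
suffice and the dependence between X⁰ and the rest of an observation is irrelevant. -/
lemma IsDataset.integral_inner_gradθ (h : IsDataset M πB P n W) {i : ℕ} (hi : i < n)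
    (π : Policy X A) (β u : Vec d) :
    ∫ ω, ⟪gradθ M φ (M.featCov φ πB) c π β (W i ω), u⟫ ∂P = ⟪meanGradθ M φ πB c π β, u⟫ := by
  have h1 : ∀ s : Sample X A, ⟪gradθ M φ (M.featCov φ πB) c π β s, u⟫ =
      (1 - M.γ) * linValue φ π u s.x0 +
        ⟪φ s.x s.a, powApply (M.featCov φ πB) (c - 1) β⟫ *
          (M.γ * linValue φ π u s.xnext - ⟪φ s.x s.a, u⟫) := by
    intro s
    simp only [gradθ_eq, inner_sub_left, inner_add_left, real_inner_smul_left, sum_inner, linValue]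
    ring
  simp only [h1]
  rw [integral_add (h.integrable_sample hi fun s => (1 - M.γ) * linValue φ π u s.x0)
      (h.integrable_sample hi fun s => ⟪φ s.x s.a, powApply (M.featCov φ πB) (c - 1) β⟫ *
          (M.γ * linValue φ π u s.xnext - ⟪φ s.x s.a, u⟫)),
    integral_const_mul, h.integral_init hi,
    h.integral_trans hi (fun x a y => ⟪φ x a, powApply (M.featCov φ πB) (c - 1) β⟫ *
          (M.γ * linValue φ π u y - ⟪φ x a, u⟫)), inner_meanGradθ]
  congr 1
  refine Finset.sum_congr rfl fun x _ => Finset.sum_congr rfl fun a _ => ?_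
  congr 1
  have : ∀ y, M.p x a y * (⟪φ x a, powApply (M.featCov φ πB) (c - 1) β⟫ *
      (M.γ * linValue φ π u y - ⟪φ x a, u⟫)) = ⟪φ x a, powApply (M.featCov φ πB) (c - 1) β⟫ *
      (M.γ * (M.p x a y * linValue φ π u y) - M.p x a y * ⟪φ x a, u⟫) := fun y => by ring
  simp only [this]
  rw [← Finset.mul_sum, Finset.sum_sub_distrib, ← Finset.mul_sum, ← Finset.sum_mul, M.p_sum,
    one_mul]

/-- The scalar residual is bounded uniformly, the 3 coming from squaring a sum of three terms; only
Λ^{c-1}φ is averaged. -/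
lemma IsDataset.integral_norm_gradβ_sq_le (h : IsDataset M πB P n W)
    (hL : (M.featCov φ πB).PosDef) {Dφ Dθ : ℝ} (hφ : ∀ x a, ‖φ x a‖ ≤ Dφ) {i : ℕ} (hi : i < n)
    (π : Policy X A) {θ : Vec d} (hθ : ‖θ‖ ≤ Dθ) :
    ∫ ω, ‖gradβ M φ (M.featCov φ πB) c π θ (W i ω)‖ ^ 2 ∂P ≤
      Gβsq M.γ Dφ Dθ (matPow (M.featCov φ πB) (2 * c - 1)).trace := by
  have hδ : ∀ s : Sample X A, (M.r s.x s.a + M.γ * linValue φ π θ s.xnext - ⟪φ s.x s.a, θ⟫) ^ 2 ≤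
      3 * (1 + (1 + M.γ ^ 2) * Dφ ^ 2 * Dθ ^ 2) := by
    intro s
    have h1 : M.r s.x s.a ^ 2 ≤ 1 :=
      pow_le_one₀ (M.r_nonneg _ _) (M.r_le_one _ _)
    have h2 : linValue φ π θ s.xnext ^ 2 ≤ (Dφ * Dθ) ^ 2 :=
      sq_le_sq' (abs_le.1 (abs_linValue_le hφ hθ π _)).1 (abs_le.1 (abs_linValue_le hφ hθ π _)).2
    have h3 : ⟪φ s.x s.a, θ⟫ ^ 2 ≤ (Dφ * Dθ) ^ 2 :=
      sq_le_sq' (abs_le.1 (abs_inner_le hφ hθ _ _)).1 (abs_le.1 (abs_inner_le hφ hθ _ _)).2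
    have h4 := add_sq_le_three (M.r s.x s.a) (M.γ * linValue φ π θ s.xnext) (-⟪φ s.x s.a, θ⟫)
    nlinarith [mul_le_mul_of_nonneg_left h2 (sq_nonneg M.γ)]
  calc ∫ ω, ‖gradβ M φ (M.featCov φ πB) c π θ (W i ω)‖ ^ 2 ∂P
      ≤ ∫ ω, (3 * (1 + (1 + M.γ ^ 2) * Dφ ^ 2 * Dθ ^ 2)) *
          ‖powApply (M.featCov φ πB) (c - 1) (φ (W i ω).x (W i ω).a)‖ ^ 2 ∂P := by
        refine integral_mono (h.integrable_sample hi fun s => ‖gradβ M φ (M.featCov φ πB) c π θ s‖ ^ 2)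
          (h.integrable_sample hi fun s => (3 * (1 + (1 + M.γ ^ 2) * Dφ ^ 2 * Dθ ^ 2)) *
            ‖powApply (M.featCov φ πB) (c - 1) (φ s.x s.a)‖ ^ 2) fun ω => ?_
        simp only [gradβ]
        rw [norm_smul, mul_pow, Real.norm_eq_abs, sq_abs]
        exact mul_le_mul_of_nonneg_right (hδ (W i ω)) (sq_nonneg _)
    _ = Gβsq M.γ Dφ Dθ (matPow (M.featCov φ πB) (2 * c - 1)).trace := by
        rw [integral_const_mul, h.integral_pair hi
          (fun x a => ‖powApply (M.featCov φ πB) (c - 1) (φ x a)‖ ^ 2),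
          sum_occ_norm_powApply_sq hL, Gβsq]

/-- The triangle inequality first removes X⁰ and X', leaving the square of ⟨φ, Λ^{c-1}β⟩, whose mean
is a quadratic form in β. -/
lemma IsDataset.integral_norm_gradθ_sq_le (h : IsDataset M πB P n W)
    (hL : (M.featCov φ πB).PosDef) (hc : c = 1 / 2 ∨ c = 1) {Dφ Dβ : ℝ}
    (hφ : ∀ x a, ‖φ x a‖ ≤ Dφ) {i : ℕ} (hi : i < n)
    (π : Policy X A) {β : Vec d} (hβ : ‖β‖ ≤ Dβ) :
    ∫ ω, ‖gradθ M φ (M.featCov φ πB) c π β (W i ω)‖ ^ 2 ∂P ≤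
      Gθsq M.γ Dφ Dβ (opNorm (M.featCov φ πB) ^ (2 * c - 1)) := by
  set B : X → A → ℝ := fun x a => ⟪φ x a, powApply (M.featCov φ πB) (c - 1) β⟫ with hB
  have hs : ∀ s : Sample X A, ‖gradθ M φ (M.featCov φ πB) c π β s‖ ^ 2 ≤
      3 * Dφ ^ 2 * ((1 - M.γ) ^ 2 + (1 + M.γ ^ 2) * B s.x s.a ^ 2) := by
    intro s
    have hD : 0 ≤ Dφ := (norm_nonneg _).trans (hφ s.x s.a)
    have h1 : ‖gradθ M φ (M.featCov φ πB) c π β s‖ ≤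
        (1 - M.γ) * Dφ + M.γ * |B s.x s.a| * Dφ + |B s.x s.a| * Dφ := by
      rw [gradθ_eq]
      refine (norm_sub_le _ _).trans (add_le_add ((norm_add_le _ _).trans (add_le_add ?_ ?_)) ?_)
      · rw [norm_smul, Real.norm_eq_abs, abs_of_pos M.one_sub_γ_pos]
        exact mul_le_mul_of_nonneg_left (norm_meanAction_le hφ π _) M.one_sub_γ_pos.le
      · rw [norm_smul, Real.norm_eq_abs, abs_mul, abs_of_nonneg M.γ_nonneg]
        exact mul_le_mul_of_nonneg_left (norm_meanAction_le hφ π _)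
          (mul_nonneg M.γ_nonneg (abs_nonneg _))
      · rw [norm_smul, Real.norm_eq_abs]
        exact mul_le_mul_of_nonneg_left (hφ _ _) (abs_nonneg _)
    calc _ ≤ ((1 - M.γ) * Dφ + M.γ * |B s.x s.a| * Dφ + |B s.x s.a| * Dφ) ^ 2 :=
          pow_le_pow_left₀ (norm_nonneg _) h1 2
      _ ≤ _ := add_sq_le_three _ _ _
      _ = _ := by
        simp only [mul_pow, sq_abs]
        ring
  calc ∫ ω, ‖gradθ M φ (M.featCov φ πB) c π β (W i ω)‖ ^ 2 ∂P
      ≤ ∫ ω, 3 * Dφ ^ 2 * ((1 - M.γ) ^ 2 + (1 + M.γ ^ 2) * B (W i ω).x (W i ω).a ^ 2) ∂P :=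
        integral_mono (h.integrable_sample hi fun s => ‖gradθ M φ (M.featCov φ πB) c π β s‖ ^ 2)
          (h.integrable_sample hi fun s =>
            3 * Dφ ^ 2 * ((1 - M.γ) ^ 2 + (1 + M.γ ^ 2) * B s.x s.a ^ 2)) fun ω => hs _
    _ = 3 * Dφ ^ 2 * ((1 - M.γ) ^ 2 + (1 + M.γ ^ 2) *
          ⟪β, powApply (M.featCov φ πB) (2 * c - 1) β⟫) := by
        rw [integral_const_mul, integral_add (integrable_const _)
          (h.integrable_sample hi fun s => (1 + M.γ ^ 2) * B s.x s.a ^ 2), integral_const_mul,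
          h.integral_pair hi (fun x a => B x a ^ 2), sum_occ_inner_sq hL]
        simp
    _ ≤ _ := by
        have h1 := inner_powApply_le hL hc β
        have h2 : 0 ≤ opNorm (M.featCov φ πB) := norm_nonneg _
        have h3 : ⟪β, powApply (M.featCov φ πB) (2 * c - 1) β⟫ ≤
            Dβ ^ 2 * opNorm (M.featCov φ πB) ^ (2 * c - 1) := by
          rw [mul_comm (Dβ ^ 2)]
          refine h1.trans ?_
          gcongr
        rw [Gθsq, mul_assoc (1 + M.γ ^ 2)]
        gcongr

end Gradients

/-! ### Analysis of the algorithm -/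

lemma integral_sub_add {Ω : Type*} [MeasurableSpace Ω] {P : Measure Ω} {f g h : Ω → ℝ}
    (hf : Integrable f P) (hg : Integrable g P) (hh : Integrable h P) :
    ∫ ω, (f ω - g ω + h ω) ∂P = ∫ ω, f ω ∂P - ∫ ω, g ω ∂P + ∫ ω, h ω ∂P := by
  rw [← integral_sub hf hg]
  exact integral_add (hf.sub hg) hh

lemma integral_add_add {Ω : Type*} [MeasurableSpace Ω] {P : Measure Ω} {f g h : Ω → ℝ}
    (hf : Integrable f P) (hg : Integrable g P) (hh : Integrable h P) :
    ∫ ω, (f ω + g ω + h ω) ∂P = ∫ ω, f ω ∂P + ∫ ω, g ω ∂P + ∫ ω, h ω ∂P := by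
  rw [← integral_add hf hg]
  exact integral_add (hf.add hg) hh

section Algorithm

variable {X A : Type*} [Fintype X] [Fintype A] [Nonempty A] {d : ℕ} (M : MDP X A)
  (φ : X → A → Vec d) (L : Matrix (Fin d) (Fin d) ℝ) (I : AlgInput d)

/-- The inner iterate `θ_{t+1,k+1}` of the algorithm on the data `w`. -/
noncomputable def algInner (w : ℕ → Sample X A) (t k : ℕ) : Vec d :=
  innerθ M φ L I (algState M φ L I w t) (fun k => w (t * I.K + k)) k

/-- The averaged iterate `θ_{t+1}` of the algorithm on the data `w`. -/
noncomputable def algθ (w : ℕ → Sample X A) (t : ℕ) : Vec d :=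
  avgθ M φ L I (algState M φ L I w t) (fun k => w (t * I.K + k))

lemma algθ_eq (w : ℕ → Sample X A) (t : ℕ) :
    algθ M φ L I w t = (1 / (I.K : ℝ)) • ∑ k ∈ Finset.range I.K, algInner M φ L I w t k := rfl

lemma innerθ_congr (S : AlgState d) {w w' : ℕ → Sample X A} {k : ℕ}
    (h : ∀ j < k, w j = w' j) : innerθ M φ L I S w k = innerθ M φ L I S w' k := by
  induction k with
  | zero => rfl
  | succ k ih =>
    rw [innerθ, innerθ, ih fun j hj => h j (hj.trans k.lt_succ_self), h k k.lt_succ_self]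

lemma avgθ_congr (S : AlgState d) {w w' : ℕ → Sample X A}
    (h : ∀ j, j + 1 < I.K → w j = w' j) : avgθ M φ L I S w = avgθ M φ L I S w' := by
  unfold avgθ
  congr 1
  refine Finset.sum_congr rfl fun k hk => innerθ_congr M φ L I S fun j hj => h j ?_
  have := Finset.mem_range.1 hk
  omega

lemma dependsOn_algState (hK : 1 ≤ I.K) (t : ℕ) :
    DependsOn (fun w => algState M φ L I w t) (Set.Iio (t * I.K)) := by
  induction t with
  | zero => exact fun _ _ _ => rfl
  | succ t ih =>
    intro w w' h
    have hlt : ∀ k < I.K, w (t * I.K + k) = w' (t * I.K + k) := fun k hk =>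
      h _ (by rw [Set.mem_Iio, Nat.succ_mul]; omega)
    have h1 : algState M φ L I w t = algState M φ L I w' t :=
      ih fun j hj => h j (by rw [Set.mem_Iio] at hj ⊢; rw [Nat.succ_mul]; omega)
    have h2 : avgθ M φ L I (algState M φ L I w' t) (fun k => w (t * I.K + k)) =
        avgθ M φ L I (algState M φ L I w' t) (fun k => w' (t * I.K + k)) :=
      avgθ_congr M φ L I _ fun j hj => hlt j (by omega)
    simp only [algState, outerStep, h1, h2, hlt (I.K - 1) (by omega)]

lemma dependsOn_algInner (hK : 1 ≤ I.K) (t k : ℕ) :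
    DependsOn (fun w => algInner M φ L I w t k) (Set.Iio (t * I.K + k)) := by
  intro w w' h
  have h1 : algState M φ L I w t = algState M φ L I w' t :=
    dependsOn_algState M φ L I hK t fun j hj => h j (by rw [Set.mem_Iio] at hj ⊢; omega)
  simp only [algInner, h1]
  exact innerθ_congr M φ L I _ fun j hj => h _ (by rw [Set.mem_Iio]; omega)

/-- The average stops at θ_{t,K} and so spends only K - 1 observations of its block. The last one
stays independent of θ_t and serves the ascent step for β. -/
lemma dependsOn_algθ (hK : 1 ≤ I.K) (t : ℕ) :
    DependsOn (fun w => algθ M φ L I w t) (Set.Iio (t * I.K + (I.K - 1))) := by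
  intro w w' h
  have h1 : algState M φ L I w t = algState M φ L I w' t :=
    dependsOn_algState M φ L I hK t fun j hj => h j (by rw [Set.mem_Iio] at hj ⊢; omega)
  simp only [algθ, h1]
  exact avgθ_congr M φ L I _ fun j hj => h _ (by rw [Set.mem_Iio]; omega)

lemma norm_innerθ_le (hD : 0 ≤ I.Dθ) {S : AlgState d} (hS : ‖S.θprev‖ ≤ I.Dθ)
    (w : ℕ → Sample X A) (k : ℕ) : ‖innerθ M φ L I S w k‖ ≤ I.Dθ := by
  cases k with
  | zero => exact hS
  | succ k => exact norm_projBall_le hD _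

lemma norm_avgθ_le (hK : 1 ≤ I.K) (hD : 0 ≤ I.Dθ) {S : AlgState d} (hS : ‖S.θprev‖ ≤ I.Dθ)
    (w : ℕ → Sample X A) : ‖avgθ M φ L I S w‖ ≤ I.Dθ := by
  have hK' : (0 : ℝ) < I.K := by exact_mod_cast hK
  have h1 : ‖∑ k ∈ Finset.range I.K, innerθ M φ L I S w k‖ ≤ I.K * I.Dθ := by
    refine (norm_sum_le_of_le _ fun k _ => norm_innerθ_le M φ L I hD hS w k).trans_eq ?_
    simp
  rw [avgθ, norm_smul, Real.norm_eq_abs, abs_of_nonneg (by positivity), one_div,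
    inv_mul_le_iff₀ hK']
  exact h1

lemma norm_algState_θprev_le (hK : 1 ≤ I.K) (hθ₀ : ‖I.θ₀‖ ≤ I.Dθ) (w : ℕ → Sample X A) (t : ℕ) :
    ‖(algState M φ L I w t).θprev‖ ≤ I.Dθ := by
  induction t with
  | zero => exact hθ₀
  | succ t ih => exact norm_avgθ_le M φ L I hK ((norm_nonneg _).trans hθ₀) ih _

lemma norm_algInner_le (hK : 1 ≤ I.K) (hθ₀ : ‖I.θ₀‖ ≤ I.Dθ) (w : ℕ → Sample X A) (t k : ℕ) :
    ‖algInner M φ L I w t k‖ ≤ I.Dθ :=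
  norm_innerθ_le M φ L I ((norm_nonneg _).trans hθ₀) (norm_algState_θprev_le M φ L I hK hθ₀ w t) _ k

lemma norm_algθ_le (hK : 1 ≤ I.K) (hθ₀ : ‖I.θ₀‖ ≤ I.Dθ) (w : ℕ → Sample X A) (t : ℕ) :
    ‖algθ M φ L I w t‖ ≤ I.Dθ :=
  norm_avgθ_le M φ L I hK ((norm_nonneg _).trans hθ₀) (norm_algState_θprev_le M φ L I hK hθ₀ w t) _

lemma norm_algState_β_le (hβ₁ : ‖I.β₁‖ ≤ I.Dβ) (w : ℕ → Sample X A) (t : ℕ) :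
    ‖(algState M φ L I w t).β‖ ≤ I.Dβ := by
  cases t with
  | zero => exact hβ₁
  | succ t => exact norm_projBall_le ((norm_nonneg _).trans hβ₁) _

lemma algState_θsum (w : ℕ → Sample X A) (t : ℕ) :
    (algState M φ L I w t).θsum = ∑ i ∈ Finset.range t, algθ M φ L I w i := by
  induction t with
  | zero => rfl
  | succ t ih => rw [Finset.sum_range_succ, ← ih]; rfl

/-- Regret of the policies of the algorithm against any comparator. -/
lemma policy_regret_le (hK : 1 ≤ I.K) (hα : 0 < I.α) (hθ₀ : ‖I.θ₀‖ ≤ I.Dθ) {Dφ : ℝ}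
    (hφ : ∀ x a, ‖φ x a‖ ≤ Dφ) (πs : Policy X A) (w : ℕ → Sample X A) (T : ℕ) :
    ∑ t ∈ Finset.range T, ∑ x, M.stateOcc πs x *
        ∑ a, (πs.prob x a - (algPolicy M φ L I w t).prob x a) * ⟪φ x a, algθ M φ L I w t⟫ ≤
      Real.log (Fintype.card A) / I.α + T * (I.α * (Dφ * I.Dθ) ^ 2 / 2) := by
  rw [Finset.sum_comm]
  calc _ ≤ ∑ x, M.stateOcc πs x *
        (Real.log (Fintype.card A) / I.α + T * (I.α * (Dφ * I.Dθ) ^ 2 / 2)) := by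
        refine Finset.sum_le_sum fun x _ => ?_
        rw [← Finset.mul_sum]
        refine mul_le_mul_of_nonneg_left ?_ (M.stateOcc_nonneg πs x)
        have := exp_weights_regret (u := fun t a => ⟪φ x a, algθ M φ L I w t⟫) hα
          (fun t a => abs_inner_le hφ (norm_algθ_le M φ L I hK hθ₀ w t) x a)
          (πs.nonneg x) (πs.sum_one x) T
        simpa only [algPolicy, statePolicy, softmaxPolicy, algState_θsum, inner_sum] using this
    _ = _ := by rw [← Finset.sum_mul, M.sum_stateOcc, one_mul]

variable {M φ I} {πB : Policy X A} {Ω : Type*} [MeasurableSpace Ω] {P : Measure Ω}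
  [IsProbabilityMeasure P] {T : ℕ} {W : ℕ → Ω → Sample X A}

lemma block_lt {t T k K : ℕ} (ht : t < T) (hk : k < K) : t * K + k < T * K :=
  calc t * K + k < (t + 1) * K := by rw [Nat.succ_mul]; omega
    _ ≤ T * K := Nat.mul_le_mul_right K ht

/-- One ascent step for `β`, in expectation. -/
lemma IsDataset.gradβ_step (h : IsDataset M πB P (T * I.K) W) (hL : (M.featCov φ πB).PosDef)
    (hK : 1 ≤ I.K) (hζ : 0 < I.ζ) (hθ₀ : ‖I.θ₀‖ ≤ I.Dθ) {Dφ : ℝ} (hφ : ∀ x a, ‖φ x a‖ ≤ Dφ)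
    {βs : Vec d} (hβs : ‖βs‖ ≤ I.Dβ) {t : ℕ} (ht : t < T) :
    2 * I.ζ * ∫ ω, ⟪meanGradβ M φ πB I.c (algPolicy M φ (M.featCov φ πB) I (fun i => W i ω) t)
        (algθ M φ (M.featCov φ πB) I (fun i => W i ω) t),
        βs - (algState M φ (M.featCov φ πB) I (fun i => W i ω) t).β⟫ ∂P ≤
      ∫ ω, ‖(algState M φ (M.featCov φ πB) I (fun i => W i ω) t).β - βs‖ ^ 2 ∂P -
      ∫ ω, ‖(algState M φ (M.featCov φ πB) I (fun i => W i ω) (t + 1)).β - βs‖ ^ 2 ∂P +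
      I.ζ ^ 2 * Gβsq M.γ Dφ I.Dθ (matPow (M.featCov φ πB) (2 * I.c - 1)).trace := by
  set L := M.featCov φ πB with hLdef
  set G := Gβsq M.γ Dφ I.Dθ (matPow L (2 * I.c - 1)).trace with hG
  have hi : t * I.K + (I.K - 1) < T * I.K := block_lt ht (by omega)
  have hdS : DependsOn (fun w => algState M φ L I w t) (Set.Iio (t * I.K + (I.K - 1))) :=
    (dependsOn_algState M φ L I hK t).mono (Set.Iio_subset_Iio (by omega))
  have hdθ := dependsOn_algθ M φ L I hK t
  set a : (ℕ → Sample X A) → ℝ := fun w => ‖(algState M φ L I w t).β - βs‖ ^ 2 with ha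
  set b : (ℕ → Sample X A) → ℝ := fun w => ⟪meanGradβ M φ πB I.c (algPolicy M φ L I w t)
        (algθ M φ L I w t), βs - (algState M φ L I w t).β⟫ with hb
  have hda : DependsOn a (Set.Iio (t * I.K + (I.K - 1))) := fun w w' hw => by
    simp only [ha, show algState M φ L I w t = algState M φ L I w' t from hdS hw]
  have hdb : DependsOn b (Set.Iio (t * I.K + (I.K - 1))) := fun w w' hw => by
    simp only [hb, algPolicy, show algState M φ L I w t = algState M φ L I w' t from hdS hw,
      show algθ M φ L I w t = algθ M φ L I w' t from hdθ hw]
  have key := h.integral_fresh_le hi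
    (f := fun w s => ‖projBall I.Dβ ((algState M φ L I w t).β +
      I.ζ • gradβ M φ L I.c (algPolicy M φ L I w t) (algθ M φ L I w t) s) - βs‖ ^ 2)
    (g := fun w => a w - 2 * I.ζ * b w + I.ζ ^ 2 * G)
    (fun s w w' hw => by
      simp only [algPolicy, show algState M φ L I w t = algState M φ L I w' t from hdS hw,
        show algθ M φ L I w t = algθ M φ L I w' t from hdθ hw])
    (fun w w' hw => by simp only [hda hw, hdb hw])
    (fun w => by
      set g : Sample X A → Vec d :=
        gradβ M φ L I.c (algPolicy M φ L I w t) (algθ M φ L I w t) with hg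
      set β := (algState M φ L I w t).β with hβ
      have hint1 := h.integrable_sample hi (fun s => 2 * I.ζ * ⟪g s, βs - β⟫)
      have hint2 := h.integrable_sample hi (fun s => I.ζ ^ 2 * ‖g s‖ ^ 2)
      calc ∫ ω, ‖projBall I.Dβ (β + I.ζ • g (W (t * I.K + (I.K - 1)) ω)) - βs‖ ^ 2 ∂P
          ≤ ∫ ω, (a w - 2 * I.ζ * ⟪g (W (t * I.K + (I.K - 1)) ω), βs - β⟫ +
              I.ζ ^ 2 * ‖g (W (t * I.K + (I.K - 1)) ω)‖ ^ 2) ∂P := by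
            refine integral_mono (h.integrable_sample hi fun s =>
              ‖projBall I.Dβ (β + I.ζ • g s) - βs‖ ^ 2)
              (((integrable_const _).sub hint1).add hint2) fun ω => ?_
            -- Ascent is descent with rate -ζ.
            have h1 := projBall_step hβs β (g (W (t * I.K + (I.K - 1)) ω)) (-I.ζ)
            rw [neg_smul, sub_neg_eq_add, ← neg_sub βs β, inner_neg_right, norm_neg] at h1
            simp only [ha, ← hβ]
            rw [norm_sub_rev β βs]
            linarith
        _ = a w - 2 * I.ζ * b w + I.ζ ^ 2 * ∫ ω, ‖g (W (t * I.K + (I.K - 1)) ω)‖ ^ 2 ∂P := by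
            rw [integral_sub_add (integrable_const _) hint1 hint2, integral_const_mul,
              integral_const_mul,
              hg, h.integral_inner_gradβ hi]
            simp [hb, hβ]
        _ ≤ _ := by
            gcongr
            exact h.integral_norm_gradβ_sq_le hL hφ hi _ (norm_algθ_le M φ L I hK hθ₀ w t))
  have hia := h.integrable hi.le hda
  have hib := h.integrable hi.le hdb
  rw [integral_sub_add hia (hib.const_mul _) (integrable_const _), integral_const_mul,
    integral_const] at key
  simp only [probReal_univ, one_smul] at key
  have hnext : ∀ w : ℕ → Sample X A, (algState M φ L I w (t + 1)).β =
      projBall I.Dβ ((algState M φ L I w t).β + I.ζ • gradβ M φ L I.c (algPolicy M φ L I w t)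
        (algθ M φ L I w t) (w (t * I.K + (I.K - 1)))) := fun w => rfl
  simp only [hnext]
  linarith

/-- One descent step of the inner loop, in expectation. -/
lemma IsDataset.gradθ_step (h : IsDataset M πB P (T * I.K) W) (hL : (M.featCov φ πB).PosDef)
    (hc : I.c = 1 / 2 ∨ I.c = 1) (hK : 1 ≤ I.K) (hβ₁ : ‖I.β₁‖ ≤ I.Dβ)
    {Dφ : ℝ} (hφ : ∀ x a, ‖φ x a‖ ≤ Dφ)
    {Θ : Policy X A → Vec d} (hΘ : ∀ π, ‖Θ π‖ ≤ I.Dθ) {t k : ℕ} (ht : t < T) (hk : k < I.K) :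
    2 * I.η * ∫ ω, ⟪meanGradθ M φ πB I.c (algPolicy M φ (M.featCov φ πB) I (fun i => W i ω) t)
        (algState M φ (M.featCov φ πB) I (fun i => W i ω) t).β,
        algInner M φ (M.featCov φ πB) I (fun i => W i ω) t k -
          Θ (algPolicy M φ (M.featCov φ πB) I (fun i => W i ω) t)⟫ ∂P ≤
      ∫ ω, ‖algInner M φ (M.featCov φ πB) I (fun i => W i ω) t k -
          Θ (algPolicy M φ (M.featCov φ πB) I (fun i => W i ω) t)‖ ^ 2 ∂P -
      ∫ ω, ‖algInner M φ (M.featCov φ πB) I (fun i => W i ω) t (k + 1) -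
          Θ (algPolicy M φ (M.featCov φ πB) I (fun i => W i ω) t)‖ ^ 2 ∂P +
      I.η ^ 2 * Gθsq M.γ Dφ I.Dβ (opNorm (M.featCov φ πB) ^ (2 * I.c - 1)) := by
  set L := M.featCov φ πB with hLdef
  set G := Gθsq M.γ Dφ I.Dβ (opNorm L ^ (2 * I.c - 1)) with hG
  -- The case k = K - 1 is a virtual step, absent from the average. It reuses the observation of the
  -- β step, which is harmless since the inner iterate in question does not depend on it.
  have hi : t * I.K + k < T * I.K := block_lt ht hk
  have hdS : DependsOn (fun w => algState M φ L I w t) (Set.Iio (t * I.K + k)) :=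
    (dependsOn_algState M φ L I hK t).mono (Set.Iio_subset_Iio (by omega))
  have hdθ := dependsOn_algInner M φ L I hK t k
  set a : (ℕ → Sample X A) → ℝ := fun w =>
    ‖algInner M φ L I w t k - Θ (algPolicy M φ L I w t)‖ ^ 2 with ha
  set b : (ℕ → Sample X A) → ℝ := fun w => ⟪meanGradθ M φ πB I.c (algPolicy M φ L I w t)
        (algState M φ L I w t).β, algInner M φ L I w t k - Θ (algPolicy M φ L I w t)⟫ with hb
  have hda : DependsOn a (Set.Iio (t * I.K + k)) := fun w w' hw => by
    simp only [ha, algPolicy, show algState M φ L I w t = algState M φ L I w' t from hdS hw,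
      show algInner M φ L I w t k = algInner M φ L I w' t k from hdθ hw]
  have hdb : DependsOn b (Set.Iio (t * I.K + k)) := fun w w' hw => by
    simp only [hb, algPolicy, show algState M φ L I w t = algState M φ L I w' t from hdS hw,
      show algInner M φ L I w t k = algInner M φ L I w' t k from hdθ hw]
  have key := h.integral_fresh_le hi
    (f := fun w s => ‖projBall I.Dθ (algInner M φ L I w t k -
      I.η • gradθ M φ L I.c (algPolicy M φ L I w t) (algState M φ L I w t).β s) -
        Θ (algPolicy M φ L I w t)‖ ^ 2)
    (g := fun w => a w - 2 * I.η * b w + I.η ^ 2 * G)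
    (fun s w w' hw => by
      simp only [algPolicy, show algState M φ L I w t = algState M φ L I w' t from hdS hw,
        show algInner M φ L I w t k = algInner M φ L I w' t k from hdθ hw])
    (fun w w' hw => by simp only [hda hw, hdb hw])
    (fun w => by
      set g : Sample X A → Vec d :=
        gradθ M φ L I.c (algPolicy M φ L I w t) (algState M φ L I w t).β with hg
      set u := Θ (algPolicy M φ L I w t) with hu
      set θ := algInner M φ L I w t k with hθ
      have hint1 := h.integrable_sample hi (fun s => 2 * I.η * ⟪g s, θ - u⟫)
      have hint2 := h.integrable_sample hi (fun s => I.η ^ 2 * ‖g s‖ ^ 2)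
      calc ∫ ω, ‖projBall I.Dθ (θ - I.η • g (W (t * I.K + k) ω)) - u‖ ^ 2 ∂P
          ≤ ∫ ω, (a w - 2 * I.η * ⟪g (W (t * I.K + k) ω), θ - u⟫ +
              I.η ^ 2 * ‖g (W (t * I.K + k) ω)‖ ^ 2) ∂P :=
            integral_mono (h.integrable_sample hi fun s =>
              ‖projBall I.Dθ (θ - I.η • g s) - u‖ ^ 2)
              (((integrable_const _).sub hint1).add hint2) fun ω => projBall_step (hΘ _) θ _ _
        _ = a w - 2 * I.η * b w + I.η ^ 2 * ∫ ω, ‖g (W (t * I.K + k) ω)‖ ^ 2 ∂P := by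
            rw [integral_sub_add (integrable_const _) hint1 hint2, integral_const_mul,
              integral_const_mul,
              hg, h.integral_inner_gradθ hi]
            simp [hb, hu, hθ]
        _ ≤ _ := by
            gcongr
            exact h.integral_norm_gradθ_sq_le hL hc hφ hi _ (norm_algState_β_le M φ L I hβ₁ w t))
  have hia := h.integrable hi.le hda
  have hib := h.integrable hi.le hdb
  rw [integral_sub_add hia (hib.const_mul _) (integrable_const _), integral_const_mul,
    integral_const] at key
  simp only [probReal_univ, one_smul] at key
  have hnext : ∀ w : ℕ → Sample X A, algInner M φ L I w t (k + 1) =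
      projBall I.Dθ (algInner M φ L I w t k - I.η • gradθ M φ L I.c (algPolicy M φ L I w t)
        (algState M φ L I w t).β (w (t * I.K + k))) := fun w => rfl
  simp only [hnext]
  linarith

lemma norm_sub_sq_le {D : ℝ} {u v : Vec d} (hu : ‖u‖ ≤ D) (hv : ‖v‖ ≤ D) :
    ‖u - v‖ ^ 2 ≤ 4 * D ^ 2 := by
  have h := (norm_sub_le u v).trans (add_le_add hu hv)
  nlinarith [norm_nonneg (u - v)]

/-- Regret of the ascent steps for `β`, in expectation. -/
lemma IsDataset.regret_β_le (h : IsDataset M πB P (T * I.K) W) (hL : (M.featCov φ πB).PosDef)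
    (hK : 1 ≤ I.K) (hζ : 0 < I.ζ) (hθ₀ : ‖I.θ₀‖ ≤ I.Dθ) (hβ₁ : ‖I.β₁‖ ≤ I.Dβ) {Dφ : ℝ}
    (hφ : ∀ x a, ‖φ x a‖ ≤ Dφ) {βs : Vec d} (hβs : ‖βs‖ ≤ I.Dβ) :
    ∑ t ∈ Finset.range T, ∫ ω, ⟪meanGradβ M φ πB I.c
        (algPolicy M φ (M.featCov φ πB) I (fun i => W i ω) t)
        (algθ M φ (M.featCov φ πB) I (fun i => W i ω) t),
        βs - (algState M φ (M.featCov φ πB) I (fun i => W i ω) t).β⟫ ∂P ≤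
      2 * I.Dβ ^ 2 / I.ζ +
        T * (I.ζ * Gβsq M.γ Dφ I.Dθ (matPow (M.featCov φ πB) (2 * I.c - 1)).trace / 2) := by
  have h1 := Finset.sum_le_sum fun t (ht : t ∈ Finset.range T) =>
    h.gradβ_step hL hK hζ hθ₀ hφ hβs (Finset.mem_range.1 ht)
  rw [← Finset.mul_sum, Finset.sum_add_distrib, Finset.sum_range_sub', Finset.sum_const,
    Finset.card_range, nsmul_eq_mul] at h1
  have h2 : 0 ≤ ∫ ω, ‖(algState M φ (M.featCov φ πB) I (fun i => W i ω) T).β - βs‖ ^ 2 ∂P :=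
    integral_nonneg fun ω => sq_nonneg _
  -- The telescoped sum leaves the initial distance, at most the squared diameter (2D_β)².
  have h3 : ∫ ω, ‖(algState M φ (M.featCov φ πB) I (fun i => W i ω) 0).β - βs‖ ^ 2 ∂P ≤
      4 * I.Dβ ^ 2 := by
    simp only [algState, integral_const, probReal_univ, one_smul]
    exact norm_sub_sq_le hβ₁ hβs
  have hz : (0 : ℝ) < 2 * I.ζ := by positivity
  rw [← mul_le_mul_iff_right₀ hz]
  refine (h1.trans (by linarith)).trans_eq
    (b := 4 * I.Dβ ^ 2 + T * (I.ζ ^ 2 *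
      Gβsq M.γ Dφ I.Dθ (matPow (M.featCov φ πB) (2 * I.c - 1)).trace)) ?_
  field_simp
  ring

/-- Regret of the inner loop, in expectation. -/
lemma IsDataset.regret_θ_le (h : IsDataset M πB P (T * I.K) W) (hL : (M.featCov φ πB).PosDef)
    (hc : I.c = 1 / 2 ∨ I.c = 1) (hK : 1 ≤ I.K) (hη : 0 < I.η) (hθ₀ : ‖I.θ₀‖ ≤ I.Dθ)
    (hβ₁ : ‖I.β₁‖ ≤ I.Dβ) {Dφ : ℝ} (hφ : ∀ x a, ‖φ x a‖ ≤ Dφ)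
    {Θ : Policy X A → Vec d} (hΘ : ∀ π, ‖Θ π‖ ≤ I.Dθ) {t : ℕ} (ht : t < T) :
    ∫ ω, ⟪meanGradθ M φ πB I.c (algPolicy M φ (M.featCov φ πB) I (fun i => W i ω) t)
        (algState M φ (M.featCov φ πB) I (fun i => W i ω) t).β,
        algθ M φ (M.featCov φ πB) I (fun i => W i ω) t -
          Θ (algPolicy M φ (M.featCov φ πB) I (fun i => W i ω) t)⟫ ∂P ≤
      2 * I.Dθ ^ 2 / (I.η * I.K) +
        I.η * Gθsq M.γ Dφ I.Dβ (opNorm (M.featCov φ πB) ^ (2 * I.c - 1)) / 2 := by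
  set L := M.featCov φ πB with hLdef
  have hK' : (0 : ℝ) < I.K := by exact_mod_cast hK
  have h1 := Finset.sum_le_sum fun k (hk : k ∈ Finset.range I.K) =>
    h.gradθ_step hL hc hK hβ₁ hφ hΘ ht (Finset.mem_range.1 hk)
  rw [← Finset.mul_sum, Finset.sum_add_distrib, Finset.sum_range_sub', Finset.sum_const,
    Finset.card_range, nsmul_eq_mul] at h1
  set Y : ℕ → (ℕ → Sample X A) → ℝ := fun k w =>
    ‖algInner M φ L I w t k - Θ (algPolicy M φ L I w t)‖ ^ 2 with hY
  have hdP : DependsOn (fun w => algState M φ L I w t) (Set.Iio (t * I.K)) :=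
    dependsOn_algState M φ L I hK t
  have h2 : 0 ≤ ∫ ω, Y I.K (fun i => W i ω) ∂P := integral_nonneg fun ω => sq_nonneg _
  have h3 : ∫ ω, Y 0 (fun i => W i ω) ∂P ≤ 4 * I.Dθ ^ 2 := by
    have hd : DependsOn (Y 0) (Set.Iio (t * I.K)) := fun w w' hw => by
      simp only [hY, algInner, innerθ, algPolicy,
        show algState M φ L I w t = algState M φ L I w' t from hdP hw]
    have := integral_mono (μ := P) (h.integrable (Nat.mul_le_mul_right _ ht.le) hd)
      (integrable_const (4 * I.Dθ ^ 2)) fun ω =>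
      norm_sub_sq_le (norm_algInner_le M φ L I hK hθ₀ (fun i => W i ω) t 0) (hΘ _)
    simpa using this
  -- The mean gradient does not depend on θ, so the regret of the average is exactly the average of
  -- the regrets.
  have h4 : ∀ w : ℕ → Sample X A,
      ⟪meanGradθ M φ πB I.c (algPolicy M φ L I w t) (algState M φ L I w t).β,
        algθ M φ L I w t - Θ (algPolicy M φ L I w t)⟫ =
      1 / I.K * ∑ k ∈ Finset.range I.K,
        ⟪meanGradθ M φ πB I.c (algPolicy M φ L I w t) (algState M φ L I w t).β,
          algInner M φ L I w t k - Θ (algPolicy M φ L I w t)⟫ := by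
    intro w
    simp only [inner_sub_right, Finset.sum_sub_distrib, Finset.sum_const, Finset.card_range,
      nsmul_eq_mul, algθ_eq, real_inner_smul_right, inner_sum, mul_sub]
    rw [← mul_assoc (1 / (I.K : ℝ)) (I.K : ℝ), one_div_mul_cancel hK'.ne', one_mul]
  have h5 : ∀ k ∈ Finset.range I.K, Integrable (fun ω =>
      ⟪meanGradθ M φ πB I.c (algPolicy M φ L I (fun i => W i ω) t)
        (algState M φ L I (fun i => W i ω) t).β,
        algInner M φ L I (fun i => W i ω) t k - Θ (algPolicy M φ L I (fun i => W i ω) t)⟫) P := by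
    intro k hk
    refine h.integrable (f := fun w =>
      ⟪meanGradθ M φ πB I.c (algPolicy M φ L I w t) (algState M φ L I w t).β,
          algInner M φ L I w t k - Θ (algPolicy M φ L I w t)⟫)
      (block_lt ht (Finset.mem_range.1 hk)).le fun w w' hw => ?_
    have e1 : algState M φ L I w t = algState M φ L I w' t :=
      hdP fun j hj => hw j (by rw [Set.mem_Iio] at hj ⊢; omega)
    have e2 : algInner M φ L I w t k = algInner M φ L I w' t k :=
      dependsOn_algInner M φ L I hK t k hw
    simp only [algPolicy, e1, e2]
  simp only [h4]
  rw [integral_const_mul, integral_finsetSum _ h5]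
  have hz : (0 : ℝ) < 2 * I.η * I.K := by positivity
  rw [← mul_le_mul_iff_right₀ hz]
  refine (le_of_eq ?_).trans ((h1.trans (by linarith)).trans_eq
    (b := 4 * I.Dθ ^ 2 + I.K * (I.η ^ 2 * Gθsq M.γ Dφ I.Dβ (opNorm L ^ (2 * I.c - 1)))) ?_)
  · rw [← hLdef]
    field_simp
  · field_simp
    ring

/-- Expected suboptimality of the algorithm for arbitrary learning rates and loop lengths. -/
theorem expSubopt_le (hlin : M.IsLinear φ) (hu : IsUnit (M.featCov φ πB))
    (hc : I.c = 1 / 2 ∨ I.c = 1) {Dφ : ℝ} (hφ : ∀ x a, ‖φ x a‖ ≤ Dφ)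
    (hq : ∀ π : Policy X A, ∃ θ : Vec d, (∀ x a, M.q π x a = ⟪φ x a, θ⟫) ∧ ‖θ‖ ≤ I.Dθ)
    {πs : Policy X A} (hcov : coverage M φ I.c πs πB ≤ I.Dβ ^ 2)
    (hα : 0 < I.α) (hζ : 0 < I.ζ) (hη : 0 < I.η) (hT : 1 ≤ T) (hK : 1 ≤ I.K)
    (hθ₀ : ‖I.θ₀‖ ≤ I.Dθ) (hβ₁ : ‖I.β₁‖ ≤ I.Dβ) {J : Ω → Fin T}
    (h : IsDataset M πB P (T * I.K) W) (hJ : IsUniformIndex P (T * I.K) W J) :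
    expSubopt M φ πB πs I P W J ≤
      2 * I.Dβ ^ 2 / (I.ζ * T) + Real.log (Fintype.card A) / (I.α * T)
        + 2 * I.Dθ ^ 2 / (I.η * I.K)
        + I.ζ * Gβsq M.γ Dφ I.Dθ (matPow (M.featCov φ πB) (2 * I.c - 1)).trace / 2
        + I.α * I.Dθ ^ 2 * Dφ ^ 2 / 2
        + I.η * Gθsq M.γ Dφ I.Dβ (opNorm (M.featCov φ πB) ^ (2 * I.c - 1)) / 2 := by
  have hL := featCov_posDef hu
  -- The comparator for θ is a function of the policy alone, so along the algorithm it is frozen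
  -- within each inner loop.
  choose Θ hΘq hΘ using hq
  have hT' : (0 : ℝ) < T := by exact_mod_cast hT
  set L := M.featCov φ πB with hLdef
  set βs := powApply L (-I.c) (meanFeat M φ πs) with hβsdef
  have hβs : ‖βs‖ ≤ I.Dβ := by
    rw [coverage_eq hL] at hcov
    exact (pow_le_pow_iff_left₀ (norm_nonneg _) ((norm_nonneg _).trans hβ₁) two_ne_zero).1 hcov
  set reg : ℕ → (ℕ → Sample X A) → ℝ := fun t w => ∑ x, M.stateOcc πs x *
    ∑ a, (πs.prob x a - (algPolicy M φ L I w t).prob x a) * ⟪φ x a, algθ M φ L I w t⟫ with hreg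
  set rβ : ℕ → (ℕ → Sample X A) → ℝ := fun t w => ⟪meanGradβ M φ πB I.c (algPolicy M φ L I w t)
    (algθ M φ L I w t), βs - (algState M φ L I w t).β⟫ with hrβ
  set rθ : ℕ → (ℕ → Sample X A) → ℝ := fun t w => ⟪meanGradθ M φ πB I.c (algPolicy M φ L I w t)
    (algState M φ L I w t).β, algθ M φ L I w t - Θ (algPolicy M φ L I w t)⟫ with hrθ
  have hdep : ∀ t < T, ∀ w w' : ℕ → Sample X A, (∀ i ∈ Set.Iio (T * I.K), w i = w' i) →
      algState M φ L I w t = algState M φ L I w' t ∧ algθ M φ L I w t = algθ M φ L I w' t := by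
    intro t ht w w' hw
    have hlt : t * I.K + (I.K - 1) < T * I.K := block_lt ht (by omega)
    exact ⟨dependsOn_algState M φ L I hK t fun j hj => hw j (by rw [Set.mem_Iio] at hj ⊢; omega),
      dependsOn_algθ M φ L I hK t fun j hj => hw j (by rw [Set.mem_Iio] at hj ⊢; omega)⟩
  have hiβ : ∀ t < T, Integrable (fun ω => rβ t fun i => W i ω) P := fun t ht =>
    h.integrable le_rfl fun w w' hw => by
      simp only [hrβ, algPolicy, (hdep t ht w w' hw).1, (hdep t ht w w' hw).2]
  have hiθ : ∀ t < T, Integrable (fun ω => rθ t fun i => W i ω) P := fun t ht =>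
    h.integrable le_rfl fun w w' hw => by
      simp only [hrθ, algPolicy, (hdep t ht w w' hw).1, (hdep t ht w w' hw).2]
  have hireg : ∀ t < T, Integrable (fun ω => reg t fun i => W i ω) P := fun t ht =>
    h.integrable le_rfl fun w w' hw => by
      simp only [hreg, algPolicy, (hdep t ht w w' hw).1, (hdep t ht w w' hw).2]
  have hJint := hJ.integral_eq h (f := fun t w => M.subopt πs (algPolicy M φ L I w t))
    fun t ht w w' hw => by simp only [algPolicy, (hdep t ht w w' hw).1]
  have hsplit : ∀ t < T, ∫ ω, M.subopt πs (algPolicy M φ L I (fun i => W i ω) t) ∂P =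
      ∫ ω, reg t (fun i => W i ω) ∂P + ∫ ω, rβ t (fun i => W i ω) ∂P +
        ∫ ω, rθ t (fun i => W i ω) ∂P := by
    intro t ht
    rw [← integral_add_add (hireg t ht) (hiβ t ht) (hiθ t ht)]
    exact integral_congr_ae (Filter.Eventually.of_forall fun ω =>
      subopt_eq hlin hL πs _ (hΘq _) _ _)
  have hsum1 : ∑ t ∈ Finset.range T, ∫ ω, reg t (fun i => W i ω) ∂P ≤
      Real.log (Fintype.card A) / I.α + T * (I.α * (Dφ * I.Dθ) ^ 2 / 2) := by
    rw [← integral_finsetSum _ fun t ht => hireg t (Finset.mem_range.1 ht)]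
    have := integral_mono (μ := P)
      (integrable_finsetSum _ fun t ht => hireg t (Finset.mem_range.1 ht)) (integrable_const _)
      fun ω => policy_regret_le M φ L I hK hα hθ₀ hφ πs (fun i => W i ω) T
    simpa using this
  have hsum2 := h.regret_β_le hL hK hζ hθ₀ hβ₁ hφ hβs
  have hsum3 := Finset.sum_le_sum fun t (ht : t ∈ Finset.range T) =>
    h.regret_θ_le hL hc hK hη hθ₀ hβ₁ hφ hΘ (Finset.mem_range.1 ht)
  rw [Finset.sum_const, Finset.card_range, nsmul_eq_mul] at hsum3
  rw [expSubopt, hJint, Finset.sum_congr rfl fun t ht => hsplit t (Finset.mem_range.1 ht),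
    Finset.sum_add_distrib, Finset.sum_add_distrib]
  calc _ ≤ 1 / (T : ℝ) * (Real.log (Fintype.card A) / I.α + T * (I.α * (Dφ * I.Dθ) ^ 2 / 2) +
        (2 * I.Dβ ^ 2 / I.ζ + T * (I.ζ * Gβsq M.γ Dφ I.Dθ (matPow L (2 * I.c - 1)).trace / 2)) +
        T * (2 * I.Dθ ^ 2 / (I.η * I.K) +
          I.η * Gθsq M.γ Dφ I.Dβ (opNorm L ^ (2 * I.c - 1)) / 2)) := by
        gcongr
    _ = _ := by
        field_simp
        ring

end Algorithm

/-! ### Tuning -/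

section Tuning

/-- The two terms of a gradient regret balance at the tuned learning rate. -/
lemma tuned_rate {D G N : ℝ} (hD : 0 < D) (hG : 0 < G) (hN : 0 < N) :
    2 * D ^ 2 / (2 * D / (√G * √N) * N) + 2 * D / (√G * √N) * G / 2 = 2 * D * √G / √N := by
  obtain ⟨g, hg, rfl⟩ : ∃ g, 0 < g ∧ g ^ 2 = G := ⟨√G, Real.sqrt_pos.2 hG, Real.sq_sqrt hG.le⟩
  obtain ⟨s, hs, rfl⟩ : ∃ s, 0 < s ∧ s ^ 2 = N := ⟨√N, Real.sqrt_pos.2 hN, Real.sq_sqrt hN.le⟩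
  rw [Real.sqrt_sq hg.le, Real.sqrt_sq hs.le]
  field_simp
  norm_num

/-- At this rate both terms on the left equal √(2l) e / (2√N). -/
lemma tuned_rate_policy {e l N : ℝ} (he : 0 < e) (hl : 0 < l) (hN : 0 < N) :
    l / (√(2 * l) / (e * √N) * N) + √(2 * l) / (e * √N) * e ^ 2 / 2 = √(2 * l) * e / √N := by
  have h2l : 0 < 2 * l := by positivity
  obtain ⟨m, hm, hml⟩ : ∃ m, 0 < m ∧ m ^ 2 = 2 * l :=
    ⟨√(2 * l), Real.sqrt_pos.2 h2l, Real.sq_sqrt h2l.le⟩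
  obtain ⟨s, hs, rfl⟩ : ∃ s, 0 < s ∧ s ^ 2 = N := ⟨√N, Real.sqrt_pos.2 hN, Real.sq_sqrt hN.le⟩
  obtain rfl : l = m ^ 2 / 2 := by linarith
  rw [← hml, Real.sqrt_sq hm.le, Real.sqrt_sq hs.le]
  field_simp
  norm_num

/-- With the tuned parameters the error is at most `ε` once `T ≥ 16 S / ε²`. -/
lemma tuned_error_le {e Dθ Dβ Gβ Gθ l T K ε : ℝ} (he : 0 < e) (hθ : 0 < Dθ) (hβ : 0 < Dβ)
    (hGβ : 0 < Gβ) (hGθ : 0 < Gθ) (hl : 0 < l) (hT : 0 < T) (hε : 0 < ε)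
    (hTε : 16 * (2 * Dβ ^ 2 * Gβ + e ^ 2 * l) ≤ T * ε ^ 2)
    (hK : T * (2 * Dθ ^ 2 * Gθ) ≤ K * (2 * Dβ ^ 2 * Gβ + e ^ 2 * l)) :
    2 * Dβ * √Gβ / √T + √(2 * l) * e / √T + 2 * Dθ * √Gθ / √K ≤ ε := by
  have hS : 0 < 2 * Dβ ^ 2 * Gβ + e ^ 2 * l := by positivity
  have hK0 : 0 < K := by
    by_contra hcon
    have h1 : 0 < T * (2 * Dθ ^ 2 * Gθ) := by positivity
    nlinarith
  refine le_of_abs_le (abs_le_of_sq_le_sq ((add_sq_le_three _ _ _).trans ?_) hε.le)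
  simp only [div_pow, mul_pow, Real.sq_sqrt hGβ.le, Real.sq_sqrt hGθ.le, Real.sq_sqrt hT.le,
    Real.sq_sqrt hK0.le, Real.sq_sqrt (show 0 ≤ 2 * l by positivity)]
  -- The choice of K makes the squared inner error at most the sum of the other two squares,
  -- computed in `h4`.
  have h3 : 2 ^ 2 * Dθ ^ 2 * Gθ / K ≤ 2 * (2 * Dβ ^ 2 * Gβ + e ^ 2 * l) / T := by
    rw [div_le_div_iff₀ hK0 hT]
    linarith
  have h4 : 2 ^ 2 * Dβ ^ 2 * Gβ / T + 2 * l * e ^ 2 / T =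
      2 * (2 * Dβ ^ 2 * Gβ + e ^ 2 * l) / T := by
    rw [← add_div]
    congr 1
    ring
  have h5 : 16 * (2 * Dβ ^ 2 * Gβ + e ^ 2 * l) / T ≤ ε ^ 2 := by
    rw [div_le_iff₀ hT]
    linarith
  have h6 : 16 * (2 * Dβ ^ 2 * Gβ + e ^ 2 * l) / T =
      8 * (2 * (2 * Dβ ^ 2 * Gβ + e ^ 2 * l) / T) := by ring
  -- With S = 2D_β²G_β + e²l the squared error is at most 3 · 4S/T = 12S/T, below 16S/T ≤ ε².
  nlinarith [sq_nonneg ε]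

/-- Rounding up `16 S / ε²` and then `T₀ Q / S` costs only constant factors. -/
lemma ceil_mul_ceil_le {S Q ε : ℝ} (hS : 1 / 2 ≤ S) (hQ : 1 ≤ Q) (hε : 0 < ε) (hε1 : ε ≤ 1) :
    ((⌈16 * S / ε ^ 2⌉₊ * ⌈(⌈16 * S / ε ^ 2⌉₊ : ℝ) * (Q / S)⌉₊ : ℕ) : ℝ) ≤
      342 * (S * Q) / ε ^ 4 := by
  have hS0 : 0 < S := by linarith
  have hε2 : 0 < ε ^ 2 := by positivity
  have hε2' : ε ^ 2 ≤ 1 := pow_le_one₀ hε.le hε1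
  -- Since S ≥ 1/2 and ε ≤ 1, the 1 lost in rounding up is at most 2S/ε²; likewise Q ≥ 1 absorbs the
  -- second rounding.
  have h1 : (⌈16 * S / ε ^ 2⌉₊ : ℝ) ≤ 18 * S / ε ^ 2 := by
    have h2 := (Nat.ceil_lt_add_one (a := 16 * S / ε ^ 2) (by positivity)).le
    have h3 : 1 ≤ 2 * S / ε ^ 2 := by rw [le_div_iff₀ hε2]; linarith
    calc _ ≤ 16 * S / ε ^ 2 + 2 * S / ε ^ 2 := by linarith
      _ = _ := by ring
  have h4 : (⌈(⌈16 * S / ε ^ 2⌉₊ : ℝ) * (Q / S)⌉₊ : ℝ) ≤ 19 * Q / ε ^ 2 := by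
    have h2 := (Nat.ceil_lt_add_one (a := (⌈16 * S / ε ^ 2⌉₊ : ℝ) * (Q / S)) (by positivity)).le
    have h3 : 1 ≤ Q / ε ^ 2 := by rw [le_div_iff₀ hε2]; linarith
    have h5 : (⌈16 * S / ε ^ 2⌉₊ : ℝ) * (Q / S) ≤ 18 * S / ε ^ 2 * (Q / S) := by gcongr
    have h6 : 18 * S / ε ^ 2 * (Q / S) = 18 * Q / ε ^ 2 := by field_simp
    calc _ ≤ 18 * Q / ε ^ 2 + Q / ε ^ 2 := by linarith
      _ = _ := by ring
  push_cast
  calc _ ≤ 18 * S / ε ^ 2 * (19 * Q / ε ^ 2) := by gcongr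
    _ = _ := by
      field_simp
      norm_num

lemma Gβsq_le {γ Dφ Dθ τ : ℝ} (h0 : 0 ≤ γ) (h1 : γ < 1) (hD : 1 ≤ Dφ * Dθ) (hτ : 0 ≤ τ) :
    Gβsq γ Dφ Dθ τ ≤ 9 * (Dφ * Dθ) ^ 2 * τ := by
  have hγ : γ ^ 2 ≤ 1 := pow_le_one₀ h0 h1.le
  have hD2 : 1 ≤ (Dφ * Dθ) ^ 2 := one_le_pow₀ hD
  rw [Gβsq]
  refine mul_le_mul_of_nonneg_right ?_ hτ
  nlinarith [mul_le_mul_of_nonneg_right hγ (sq_nonneg (Dφ * Dθ))]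

lemma Gβsq_pos {γ Dφ Dθ τ : ℝ} (hτ : 0 < τ) : 0 < Gβsq γ Dφ Dθ τ := by
  unfold Gβsq
  positivity

lemma Gθsq_le {γ Dφ Dβ ℓ : ℝ} (h0 : 0 ≤ γ) (h1 : γ < 1) (hℓ : 1 ≤ Dβ ^ 2 * ℓ) :
    Gθsq γ Dφ Dβ ℓ ≤ 9 * Dφ ^ 2 * (Dβ ^ 2 * ℓ) := by
  have hγ : γ ^ 2 ≤ 1 := pow_le_one₀ h0 h1.le
  have hγ' : (1 - γ) ^ 2 ≤ 1 := pow_le_one₀ (by linarith) (by linarith)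
  have h2 : (1 - γ) ^ 2 + (1 + γ ^ 2) * Dβ ^ 2 * ℓ ≤ 3 * (Dβ ^ 2 * ℓ) := by
    nlinarith [mul_le_mul_of_nonneg_right hγ (zero_le_one.trans hℓ)]
  rw [Gθsq]
  nlinarith [mul_le_mul_of_nonneg_left h2 (sq_nonneg Dφ)]

lemma le_Gθsq {γ Dφ Dβ ℓ : ℝ} (hℓ : 1 ≤ Dβ ^ 2 * ℓ) : 3 * Dφ ^ 2 ≤ Gθsq γ Dφ Dβ ℓ := by
  have h2 : 1 ≤ (1 - γ) ^ 2 + (1 + γ ^ 2) * Dβ ^ 2 * ℓ := by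
    nlinarith [mul_nonneg (sq_nonneg γ) (zero_le_one.trans hℓ), sq_nonneg (1 - γ)]
  rw [Gθsq]
  exact le_mul_of_one_le_right (by positivity) h2

lemma Gβsq_mono {γ Dφ Dθ τ τ' : ℝ} (h : τ ≤ τ') : Gβsq γ Dφ Dθ τ ≤ Gβsq γ Dφ Dθ τ' := by
  unfold Gβsq
  gcongr

lemma Gθsq_mono {γ Dφ Dβ ℓ ℓ' : ℝ} (h : ℓ ≤ ℓ') : Gθsq γ Dφ Dβ ℓ ≤ Gθsq γ Dφ Dβ ℓ' := by
  unfold Gθsq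
  gcongr

variable {X : Type u} {A : Type v} [Fintype X] [Fintype A] [Nonempty A] {d : ℕ} {M : MDP X A}
  {φ : X → A → Vec d} {πB : Policy X A} {c : ℝ}

/-- In dimension zero no inner product can equal 1. -/
lemma one_le_dim (hlin : M.IsLinear φ) : 1 ≤ d := by
  rcases Nat.eq_zero_or_pos d with rfl | hd
  · obtain ⟨u, hu⟩ := exists_inner_eq_one hlin
    have hX : Nonempty X := by
      by_contra hX
      rw [not_nonempty_iff] at hX
      simpa using M.ν₀_sum
    have := hu (Classical.arbitrary X) (Classical.arbitrary A)
    rw [Subsingleton.elim u 0, inner_zero_right] at this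
    exact absurd this zero_ne_one
  · exact hd

/-- Transfers the lower bound on D_β²ℓ to D_β²τ. For c = 1/2 it reduces to 1 ≤ d. -/
lemma opNorm_rpow_le_trace (hlin : M.IsLinear φ) (hL : (M.featCov φ πB).PosDef)
    (hc : c = 1 / 2 ∨ c = 1) :
    opNorm (M.featCov φ πB) ^ (2 * c - 1) ≤ (matPow (M.featCov φ πB) (2 * c - 1)).trace := by
  rcases hc with rfl | rfl
  · norm_num [matPow_zero hL, one_le_dim hlin]
  · rw [show (2 * 1 - 1 : ℝ) = 1 by norm_num, Real.rpow_one, matPow_one hL]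
    exact opNorm_featCov_le_trace M φ πB

/-- Sample complexity of the tuned algorithm for upper bounds `τ`, `ℓ` of the trace and the
norm. -/
theorem reachesWithin_of_le (hlin : M.IsLinear φ) (hu : IsUnit (M.featCov φ πB))
    (hc : c = 1 / 2 ∨ c = 1) {Dφ Dθ Dβ : ℝ} (hφ : ∀ x a, ‖φ x a‖ ≤ Dφ)
    (hq : ∀ π : Policy X A, ∃ θ : Vec d, (∀ x a, M.q π x a = ⟪φ x a, θ⟫) ∧ ‖θ‖ ≤ Dθ)
    (hDβ : 0 ≤ Dβ) (hA : 2 ≤ Fintype.card A) (hD : 1 ≤ Dφ * Dθ)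
    (hcov : ∃ πs : Policy X A, coverage M φ c πs πB ≤ Dβ ^ 2) {ε : ℝ} (hε : 0 < ε) (hε1 : ε ≤ 1)
    {τ ℓ : ℝ} (hτ : (matPow (M.featCov φ πB) (2 * c - 1)).trace ≤ τ)
    (hℓ : opNorm (M.featCov φ πB) ^ (2 * c - 1) ≤ ℓ) :
    ReachesWithin.{w, u, v} M φ πB c Dφ Dθ Dβ τ ℓ ε
      (227772 * (Dθ ^ 4 * Dφ ^ 4 * Dβ ^ 4 * τ * ℓ * Real.log (Fintype.card A)) / ε ^ 4) := by
  have hL := featCov_posDef hu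
  obtain ⟨π₀, hπ₀⟩ := hcov
  have hon : 0 ≤ opNorm (M.featCov φ πB) := norm_nonneg _
  have hℓ0 : 0 ≤ opNorm (M.featCov φ πB) ^ (2 * c - 1) := Real.rpow_nonneg hon _
  -- A feasible comparator forces this. It excludes D_β = 0 and absorbs the additive constants
  -- below.
  have hbℓ₀ : 1 ≤ Dβ ^ 2 * opNorm (M.featCov φ πB) ^ (2 * c - 1) :=
    (one_le_coverage_mul hlin hL hc π₀).trans (mul_le_mul_of_nonneg_right hπ₀ hℓ0)
  have hbℓ : 1 ≤ Dβ ^ 2 * ℓ := hbℓ₀.trans (mul_le_mul_of_nonneg_left hℓ (sq_nonneg _))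
  have hbτ : 1 ≤ Dβ ^ 2 * τ := hbℓ₀.trans (mul_le_mul_of_nonneg_left
    ((opNorm_rpow_le_trace hlin hL hc).trans hτ) (sq_nonneg _))
  have hDβ0 : 0 < Dβ := hDβ.lt_of_ne fun h => by rw [← h] at hbℓ; norm_num at hbℓ
  have hτ0 : 0 < τ := pos_of_mul_pos_right (zero_lt_one.trans_le hbτ) (sq_nonneg _)
  have hDθ0 : 0 ≤ Dθ := (norm_nonneg _).trans (hq π₀).choose_spec.2
  have hDθ : 0 < Dθ := hDθ0.lt_of_ne fun h => by rw [← h] at hD; norm_num at hD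
  have hDφ : 0 < Dφ := pos_of_mul_pos_left (zero_lt_one.trans_le hD) hDθ0
  have hl : 1 / 2 ≤ Real.log (Fintype.card A) := by
    have h1 : Real.log 2 ≤ Real.log (Fintype.card A) :=
      Real.log_le_log two_pos (by exact_mod_cast hA)
    linarith [Real.log_two_gt_d9]
  set l := Real.log (Fintype.card A) with hldef
  have hl0 : 0 < l := by linarith
  set Gβ := Gβsq M.γ Dφ Dθ τ with hGβ
  set Gθ := Gθsq M.γ Dφ Dβ ℓ with hGθ
  have hGβ0 : 0 < Gβ := Gβsq_pos hτ0
  have hGβ1 : Gβ ≤ 9 * (Dφ * Dθ) ^ 2 * τ := Gβsq_le M.γ_nonneg M.γ_lt_one hD hτ0.le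
  have hGθ1 : Gθ ≤ 9 * Dφ ^ 2 * (Dβ ^ 2 * ℓ) := Gθsq_le M.γ_nonneg M.γ_lt_one hbℓ
  have hGθ2 : 3 * Dφ ^ 2 ≤ Gθ := le_Gθsq hbℓ
  have hGθ0 : 0 < Gθ := lt_of_lt_of_le (by positivity) hGθ2
  have hD2 : 1 ≤ (Dφ * Dθ) ^ 2 := one_le_pow₀ hD
  set S := 2 * Dβ ^ 2 * Gβ + Dθ ^ 2 * Dφ ^ 2 * l with hS
  set Q := 2 * Dθ ^ 2 * Gθ with hQ
  have hS' : S = 2 * Dβ ^ 2 * Gβ + (Dφ * Dθ) ^ 2 * l := by rw [hS]; ring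
  have hS1 : 1 / 2 ≤ S := by
    have : 0 ≤ 2 * Dβ ^ 2 * Gβ := by positivity
    rw [hS']
    nlinarith
  have hS0 : 0 < S := by linarith
  -- The first summand of S costs 18, doubled to 36 because l ≥ 1/2; the second costs 1 because
  -- D_β²τ ≥ 1.
  have hS2 : S ≤ 37 * ((Dφ * Dθ) ^ 2 * (Dβ ^ 2 * τ) * l) := by
    have h1 : 2 * Dβ ^ 2 * Gβ ≤ 36 * ((Dφ * Dθ) ^ 2 * (Dβ ^ 2 * τ) * l) := by
      calc 2 * Dβ ^ 2 * Gβ ≤ 2 * Dβ ^ 2 * (9 * (Dφ * Dθ) ^ 2 * τ) := by gcongr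
        _ = 36 * ((Dφ * Dθ) ^ 2 * (Dβ ^ 2 * τ) * (1 / 2)) := by ring
        _ ≤ _ := by gcongr
    have h2 : (Dφ * Dθ) ^ 2 * l ≤ (Dφ * Dθ) ^ 2 * (Dβ ^ 2 * τ) * l := by
      gcongr
      exact le_mul_of_one_le_right (by positivity) hbτ
    rw [hS']
    linarith
  have hQ1 : 1 ≤ Q := by
    have : 2 * Dθ ^ 2 * (3 * Dφ ^ 2) ≤ Q := by rw [hQ]; gcongr
    nlinarith
  have hQ2 : Q ≤ 18 * ((Dφ * Dθ) ^ 2 * (Dβ ^ 2 * ℓ)) := by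
    calc Q ≤ 2 * Dθ ^ 2 * (9 * Dφ ^ 2 * (Dβ ^ 2 * ℓ)) := by rw [hQ]; gcongr
      _ = _ := by ring
  have hQ0 : 0 < Q := by linarith
  refine ⟨⌈16 * S / ε ^ 2⌉₊, Nat.one_le_ceil_iff.2 (by positivity), ?_, ?_⟩
  · refine (ceil_mul_ceil_le hS1 hQ1 hε hε1).trans ?_
    gcongr ?_ / _
    calc 342 * (S * Q) ≤ 342 * ((37 * ((Dφ * Dθ) ^ 2 * (Dβ ^ 2 * τ) * l)) *
          (18 * ((Dφ * Dθ) ^ 2 * (Dβ ^ 2 * ℓ)))) := by gcongr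
      _ = _ := by ring
  · intro T hT πs hπs θ₀ β₁ hθ₀ hβ₁ I hI Ω _ P _ W J hW hJ
    have hTS : 16 * S / ε ^ 2 ≤ T := Nat.ceil_le.1 hT
    have hT0 : (0 : ℝ) < T := lt_of_lt_of_le (by positivity) hTS
    have hT1 : 1 ≤ T := by exact_mod_cast hT0
    set K := tunedK M.γ Dφ Dθ Dβ τ ℓ l T with hK
    have hKle : (T : ℝ) * (Q / S) ≤ K := Nat.le_ceil _
    have hK0 : (0 : ℝ) < K := lt_of_lt_of_le (by positivity) hKle
    have hK1 : 1 ≤ K := by exact_mod_cast hK0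
    have hα0 : 0 < √(2 * l) / (Dφ * Dθ * √T) := by positivity
    have hζ0 : 0 < 2 * Dβ / (√Gβ * √T) := by positivity
    have hη0 : 0 < 2 * Dθ / (√Gθ * √(K : ℝ)) := by positivity
    subst hI
    have hmain := expSubopt_le (I := tunedInput c M.γ Dφ Dθ Dβ τ ℓ l T θ₀ β₁) hlin hu hc hφ hq hπs
      hα0 hζ0 hη0 hT1 hK1 hθ₀ hβ₁ hW hJ
    refine hmain.trans ?_
    have hG1 := Gβsq_mono (γ := M.γ) (Dφ := Dφ) (Dθ := Dθ) hτ
    have hG2 := Gθsq_mono (γ := M.γ) (Dφ := Dφ) (Dβ := Dβ) hℓ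
    have herr := tuned_error_le (e := Dφ * Dθ) (K := K) (by positivity) hDθ hDβ0 hGβ0 hGθ0 hl0 hT0
      hε (by rw [← hS']; rwa [div_le_iff₀ (by positivity)] at hTS)
      (by rw [← hS']; rwa [← mul_div_assoc, div_le_iff₀ hS0] at hKle)
    have e1 := tuned_rate hDβ0 hGβ0 hT0
    have e2 := tuned_rate hDθ hGθ0 hK0
    have e3 := tuned_rate_policy (e := Dφ * Dθ) (by positivity) hl0 hT0
    have h1 := mul_le_mul_of_nonneg_left hG1 hζ0.le
    have h2 := mul_le_mul_of_nonneg_left hG2 hη0.le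
    simp only [tunedInput]
    rw [← hK, ← hGβ, ← hGθ] at *
    have e4 : √(2 * l) / (Dφ * Dθ * √T) * Dθ ^ 2 * Dφ ^ 2 / 2 =
        √(2 * l) / (Dφ * Dθ * √T) * (Dφ * Dθ) ^ 2 / 2 := by ring
    rw [e4]
    linarith

end Tuning

end OfflineRL

/-! ### Assembly: the universal constant and the two tunings -/

theorem theorem1 :
    ∃ C : ℝ, 0 < C ∧
      ∀ (X : Type u) (A : Type v) [Fintype X] [Fintype A] [Nonempty A] (d : ℕ)
        (M : OfflineRL.MDP X A) (φ : X → A → OfflineRL.Vec d) (πB : OfflineRL.Policy X A)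
        (c Dφ Dθ Dβ : ℝ),
        (c = 1 / 2 ∨ c = 1) →
        M.IsLinear φ →
        (∀ x a, ‖φ x a‖ ≤ Dφ) →
        IsUnit (M.featCov φ πB) →
        (∀ π : OfflineRL.Policy X A, ∃ θ : OfflineRL.Vec d,
          (∀ x a, M.q π x a = inner ℝ (φ x a) θ) ∧ ‖θ‖ ≤ Dθ) →
        0 ≤ Dβ →
        -- error bound for arbitrary learning rates and loop lengths
        (∀ πs : OfflineRL.Policy X A, OfflineRL.coverage M φ c πs πB ≤ Dβ ^ 2 →
          ∀ (α ζ η : ℝ) (T K : ℕ) (θ₀ β₁ : OfflineRL.Vec d),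
          0 < α → 0 < ζ → 0 < η → 1 ≤ T → 1 ≤ K → ‖θ₀‖ ≤ Dθ → ‖β₁‖ ≤ Dβ →
          ∀ (Ω : Type w) [MeasurableSpace Ω] (P : MeasureTheory.Measure Ω)
            [MeasureTheory.IsProbabilityMeasure P]
            (W : ℕ → Ω → OfflineRL.Sample X A) (J : Ω → Fin T),
            OfflineRL.IsDataset M πB P (T * K) W →
            OfflineRL.IsUniformIndex P (T * K) W J →
            OfflineRL.expSubopt M φ πB πs
                { c := c, Dθ := Dθ, Dβ := Dβ, α := α, ζ := ζ, η := η, K := K,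
                  θ₀ := θ₀, β₁ := β₁ } P W J ≤
              2 * Dβ ^ 2 / (ζ * T) + Real.log (Fintype.card A) / (α * T)
                + 2 * Dθ ^ 2 / (η * K)
                + ζ * OfflineRL.Gβsq M.γ Dφ Dθ
                    (OfflineRL.matPow (M.featCov φ πB) (2 * c - 1)).trace / 2
                + α * Dθ ^ 2 * Dφ ^ 2 / 2
                + η * OfflineRL.Gθsq M.γ Dφ Dβ
                    (OfflineRL.opNorm (M.featCov φ πB) ^ (2 * c - 1)) / 2) ∧
        -- sample complexity of the tuned algorithm
        (2 ≤ Fintype.card A → 1 ≤ Dφ * Dθ →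
          (∃ πs : OfflineRL.Policy X A, OfflineRL.coverage M φ c πs πB ≤ Dβ ^ 2) →
          ∀ ε : ℝ, 0 < ε → ε ≤ 1 →
            -- tuning with the trace and the norm of the covariance matrix
            OfflineRL.ReachesWithin.{w, u, v} M φ πB c Dφ Dθ Dβ
              (OfflineRL.matPow (M.featCov φ πB) (2 * c - 1)).trace
              (OfflineRL.opNorm (M.featCov φ πB) ^ (2 * c - 1)) ε
              (C * (Dθ ^ 4 * Dφ ^ 4 * Dβ ^ 4
                * (OfflineRL.matPow (M.featCov φ πB) (2 * c - 1)).trace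
                * OfflineRL.opNorm (M.featCov φ πB) ^ (2 * c - 1)
                * Real.log (Fintype.card A)) / ε ^ 4) ∧
            -- tuning with upper bounds that do not depend on the covariance matrix
            OfflineRL.ReachesWithin.{w, u, v} M φ πB c Dφ Dθ Dβ
              (Dφ ^ (2 * (2 * c - 1)) * (d : ℝ) ^ (2 - 2 * c))
              (Dφ ^ (2 * (2 * c - 1))) ε
              (C * (Dθ ^ 4 * Dφ ^ (8 * c) * Dβ ^ 4 * (d : ℝ) ^ (2 - 2 * c)
                * Real.log (Fintype.card A)) / ε ^ 4)) := by
  -- 227772 = 342 · 37 · 18: rounding, the bound on S, and the bound on Q.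
  refine ⟨227772, by norm_num, ?_⟩
  intro X A _ _ _ d M φ πB c Dφ Dθ Dβ hc hlin hφ hu hq hDβ
  refine ⟨?_, ?_⟩
  · intro πs hπs α ζ η T K θ₀ β₁ hα hζ hη hT hK hθ₀ hβ₁ Ω _ P _ W J hW hJ
    exact OfflineRL.expSubopt_le (I := ⟨c, Dθ, Dβ, α, ζ, η, K, θ₀, β₁⟩) hlin hu hc hφ hq hπs hα hζ hη hT hK hθ₀ hβ₁ hW hJ
  · intro hA hD hcov ε hε hε1
    have hL := OfflineRL.featCov_posDef hu
    refine ⟨OfflineRL.reachesWithin_of_le hlin hu hc hφ hq hDβ hA hD hcov hε hε1 le_rfl le_rfl, ?_⟩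
    have htr := OfflineRL.trace_featCov_le (M := M) (πB := πB) hφ
    have hop := (OfflineRL.opNorm_featCov_le_trace M φ πB).trans htr
    rcases hc with rfl | rfl
    -- For c = 1/2 the matrix power is the identity, so τ = d and ℓ = 1 hold with equality.
    · have h := OfflineRL.reachesWithin_of_le.{w} hlin hu (Or.inl rfl) hφ hq hDβ hA hD hcov hε hε1
        (τ := Dφ ^ (2 * (2 * (1 / 2) - 1) : ℝ) * (d : ℝ) ^ (2 - 2 * (1 / 2) : ℝ))
        (ℓ := Dφ ^ (2 * (2 * (1 / 2) - 1) : ℝ))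
        (by norm_num [OfflineRL.matPow_zero hL]) (by norm_num)
      convert h using 4
      norm_num
    -- For c = 1 the bounds are ‖Λ‖ ≤ Tr Λ ≤ D_φ²; the real exponents are first made natural so that
    -- powers of D_φ combine.
    · have e1 : (2 * (2 * 1 - 1) : ℝ) = (2 : ℕ) := by norm_num
      have e2 : (8 * 1 : ℝ) = (8 : ℕ) := by norm_num
      have h := OfflineRL.reachesWithin_of_le.{w} hlin hu (Or.inr rfl) hφ hq hDβ hA hD hcov hε hε1
        (τ := Dφ ^ (2 * (2 * 1 - 1) : ℝ) * (d : ℝ) ^ (2 - 2 * 1 : ℝ))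
        (ℓ := Dφ ^ (2 * (2 * 1 - 1) : ℝ))
        (by
          rw [e1, Real.rpow_natCast]
          norm_num [OfflineRL.matPow_one hL, htr])
        (by
          rw [e1, Real.rpow_natCast]
          norm_num [hop])
      convert h using 4
      rw [e1, e2, Real.rpow_natCast, Real.rpow_natCast]
      ring
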